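/- **Network.** Let $u_k(i)$ ($k=1,2$) and $v_j(i)$ ($j=1,2,3$), $i\ge 1$, be mutually independent, a.s. positive random variables on a probability space $(\Omega,\mathcal F,\mathbb P)$, identically distributed in $i$, with mean $1$; let $\sigma_k,\varsigma_j$ be the standard deviations of $u_k(1),v_j(1)$. For $n\ge1$ let $\lambda^n_k,\mu^n_j>0$ with $\lambda^n_k\to\lambda_k\in(0,\infty)$, $\mu^n_j\to\mu_j\in(0,\infty)$, where $\frac{\lambda_1}{\mu_1}+\frac{\lambda_2}{\mu_2}=1$, $\frac{\lambda_2}{\mu_3}=1$, and $\sqrt n\big(\frac{\lambda^n_i}{\mu^n_i}-\frac{\lambda_i}{\mu_i}\big)\to b_i\in\mathbb R$ ($i=1,2$), $\sqrt n\big(\frac{\lambda^n_2}{\mu^n_3}-1\big)\to b_3\in\mathbb R$. Assume that $\mathbb E e^{l u_k(1)/\lambda_k}<\infty$ and $\mathbb E e^{l v_j(1)/\mu_j}<\infty$ for all $l$ in an open neighbourhood of $0$. Let $\gamma>0$ be a discount factor and $c_1,c_2,c_3>0$ holding costs with $c_2\mu_2-c_3\mu_2<0$ and $c_2\mu_2-c_1\mu_1\ge0$.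 Put $A^n_k(t)=\sup\{l\ge0:\sum_{i\le l}u_k(i)/\lambda^n_k\le t\}$ and $S^n_j(t)=\sup\{l\ge0:\sum_{i\le l}v_j(i)/\mu^n_j\le t\}$. If $T^n_j(t)$ is the service time given to class $j$ during $[0,t]$, the queue lengths and workloads are $$Q^n_i=A^n_i-S^n_i(T^n_i)\ (i=1,2),\quad Q^n_3=S^n_2(T^n_2)-S^n_3(T^n_3),\quad W^n_1=\tfrac{Q^n_1}{\mu^n_1}+\tfrac{Q^n_2}{\mu^n_2},\quad W^n_2=\tfrac{Q^n_2+Q^n_3}{\mu^n_3},$$ and the idle time of Server 2 is $I^n_2(t)=t-T^n_3(t)$. Put $\hat Q^n_2(t)=n^{-1/2}Q^n_2(nt)$ and $\hat I^n_2(t)=n^{-1/2}I^n_2(nt)$. **Free boundary.** Let $X$ be a three-dimensional Brownian motion on a filtered probability space $(\mathcal F_t)$, started at $0$, with drift $(\mu_1b_1,\mu_2b_2,\mu_3b_3-\mu_2b_2)$ and covariance matrix $$\begin{pmatrix}\sigma_1^2\lambda_1+\varsigma_1^2\lambda_1&0&0\\0&\sigma_2^2\lambda_2+\varsigma_2^2\lambda_2&-\varsigma_2^2\lambda_2\\0&-\varsigma_2^2\lambda_2&\varsigma_2^2\lambda_2+\varsigma_3^2\mu_3\end{pmatrix},$$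 and let $B_1=\frac{X_1}{\mu_1}+\frac{X_2}{\mu_2}$, $B_2=\frac{X_2+X_3}{\mu_3}$. For $w\in\mathbb R_+^2$ let $J^*(w)=\inf\mathbb E\int_0^\infty e^{-\gamma t}\hat h(\tilde W(t))\,dt$, the infimum over all such $X$ and all adapted, right continuous, nondecreasing $\mathbb R_+^2$-valued processes $\tilde I$ such that both coordinates of $\tilde W(t)=w+B(t)+\tilde I(t)$ are nonnegative for all $t\ge0$. Here $\hat h(w)=c_1\mu_1w_1+\frac{\mu_3}{\mu_2}(c_2\mu_2-c_1\mu_1)w_2$ if $\mu_3w_2\le\mu_2w_1$ and $\hat h(w)=(c_2\mu_2-c_3\mu_2)w_1+c_3\mu_3w_2$ otherwise. Put $\Psi(w_2)=\sup\{w_1\ge0:\partial_{w_1}J^*(w_1,w_2)=0\}$, with $\sup\emptyset=0$ and with the one-sided derivative at $w_1=0$. **Policy.** For $c,l_0>1$ and $g_0>0$ let $L^n=\lfloor l_0\log n\rfloor$ and $C^n=\lfloor c\,l_0\log n\rfloor$. Server 2 works whenever $Q^n_3>0$. Server 1 acts as follows, and never serves an empty buffer. * If $Q^n_3-\frac{\mu^n_2}{\mu^n_1}Q^n_1<L^n$: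 it serves Class 1 if $Q^n_3\ge C^n-1$ or $Q^n_2=0$, and Class 2 if $Q^n_3<C^n-1$ and $Q^n_2>0$. * If $Q^n_3-\frac{\mu^n_2}{\mu^n_1}Q^n_1\ge L^n$: it serves Class 1 if $Q^n_1\ge\frac{\mu^n_1}{\mu^n_2}(C^n-L^n+2)$ or $Q^n_2=0$; it serves Class 2 if $Q^n_1<\frac{\mu^n_1}{\mu^n_2}(C^n-L^n+2)$, $Q^n_2>0$ and $W^n_1-\sqrt n\,\Psi(W^n_2/\sqrt n)\ge g_0$; otherwise it idles. That is, a.s., $T^n_j(t)=\int_0^t\mathbf 1\{\text{class } j \text{ is served in state } Q^n(s)\}\,ds$ for all $t\ge0$ and $j=1,2,3$. **Theorem.** There are $n_1\in\mathbb N$ and $\epsilon\in(0,1)$, and for every $c>1$ there are $\gamma_1,\gamma_2,\gamma_3,\gamma_4,d\in(0,\infty)$ (depending on $c$), such that for all $l_0>1$, $g_0>0$, every $T^n$ generated by the policy with thresholds $c,l_0,g_0$, and all $n\ge n_1$ and $t$ with $nt\ge 2/\epsilon$, $$\mathbb P\left[\int_{[0,t)}\mathbf 1_{\{\hat Q^n_2(s)\ge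 d\,l_0\log n/\sqrt n\}}\,d\hat I^n_2(s)\ne0\right]\le\gamma_1(nt+1)^2e^{-\gamma_2nt}+\gamma_3(nt+1)^3n^{-\gamma_4l_0}.$$ -/

import Mathlib

open MeasureTheory ProbabilityTheory Filter Topology Set
open scoped NNReal ENNReal Matrix

/-- Data of a sequence of crisscross networks with two servers and three customer classes.
Classes `1, 2, 3` are indexed by `0, 1, 2`; classes `1, 2` (indices `0, 1` of `Fin 2`) have
external arrivals. The `(i+1)`-st normalized interarrival / service time is `u k i` / `v j i`. -/
structure CrisscrossData (Ω : Type*) where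
  /-- normalized interarrival times of classes 1 and 2 -/
  u : Fin 2 → ℕ → Ω → ℝ
  /-- normalized service times of classes 1, 2 and 3 -/
  v : Fin 3 → ℕ → Ω → ℝ
  /-- arrival rates in the `n`-th network -/
  lamN : ℕ → Fin 2 → ℝ
  /-- service rates in the `n`-th network -/
  muN : ℕ → Fin 3 → ℝ
  /-- limiting arrival rates -/
  lam : Fin 2 → ℝ
  /-- limiting service rates -/
  mu : Fin 3 → ℝ
  /-- second order heavy traffic parameters -/
  b : Fin 3 → ℝ
  /-- holding costs per unit time and customer -/
  cost : Fin 3 → ℝ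
  /-- discount factor of the cost -/
  disc : ℝ

namespace CrisscrossData

/-- Standing assumptions on the sequence of networks: i.i.d. positive interarrival and service
times with mean one, mutual independence, convergence of the rates, heavy traffic, exponential
moments near zero, and the cost parameter regime. -/
structure Assumptions {Ω : Type*} [MeasurableSpace Ω] (N : CrisscrossData Ω)
    (P : Measure Ω) : Prop where
  measurable_u : ∀ k i, Measurable (N.u k i)
  measurable_v : ∀ j i, Measurable (N.v j i)
  indep : iIndepFun
    (Sum.elim (fun p : Fin 2 × ℕ => N.u p.1 p.2) (fun p : Fin 3 × ℕ => N.v p.1 p.2)) P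
  identDistrib_u : ∀ k i, IdentDistrib (N.u k i) (N.u k 0) P P
  identDistrib_v : ∀ j i, IdentDistrib (N.v j i) (N.v j 0) P P
  pos_u : ∀ k i, ∀ᵐ ω ∂P, 0 < N.u k i ω
  pos_v : ∀ j i, ∀ᵐ ω ∂P, 0 < N.v j i ω
  mean_u : ∀ k, ∫ ω, N.u k 0 ω ∂P = 1
  mean_v : ∀ j, ∫ ω, N.v j 0 ω ∂P = 1
  lamN_pos : ∀ n, 1 ≤ n → ∀ k, 0 < N.lamN n k
  muN_pos : ∀ n, 1 ≤ n → ∀ j, 0 < N.muN n j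
  lam_pos : ∀ k, 0 < N.lam k
  mu_pos : ∀ j, 0 < N.mu j
  tendsto_lam : ∀ k, Tendsto (fun n => N.lamN n k) atTop (𝓝 (N.lam k))
  tendsto_mu : ∀ j, Tendsto (fun n => N.muN n j) atTop (𝓝 (N.mu j))
  traffic_one : N.lam 0 / N.mu 0 + N.lam 1 / N.mu 1 = 1
  traffic_two : N.lam 1 / N.mu 2 = 1
  heavy_one : Tendsto
    (fun n : ℕ => √(n : ℝ) * (N.lamN n 0 / N.muN n 0 - N.lam 0 / N.mu 0)) atTop (𝓝 (N.b 0))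
  heavy_two : Tendsto
    (fun n : ℕ => √(n : ℝ) * (N.lamN n 1 / N.muN n 1 - N.lam 1 / N.mu 1)) atTop (𝓝 (N.b 1))
  heavy_three : Tendsto
    (fun n : ℕ => √(n : ℝ) * (N.lamN n 1 / N.muN n 2 - 1)) atTop (𝓝 (N.b 2))
  exp_moments : ∃ O : Set ℝ, IsOpen O ∧ (0 : ℝ) ∈ O ∧ ∀ l ∈ O,
    (∀ k, Integrable (fun ω => Real.exp (l * N.u k 0 ω / N.lam k)) P) ∧
    (∀ j, Integrable (fun ω => Real.exp (l * N.v j 0 ω / N.mu j)) P)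
  cost_pos : ∀ j, 0 < N.cost j
  disc_pos : 0 < N.disc
  regime_one : N.cost 1 * N.mu 1 - N.cost 2 * N.mu 1 < 0
  regime_two : 0 ≤ N.cost 1 * N.mu 1 - N.cost 0 * N.mu 0

end CrisscrossData

/-! ### The workload control problem and its free boundary -/

/-- `X` is a three-dimensional Brownian motion with drift `m` and covariance matrix `S`, started
at the origin, relative to the filtration `F`. The Gaussian law of the increments is expressed
through all linear functionals. -/
structure IsDriftedBM {Ω : Type*} {mΩ : MeasurableSpace Ω} (Q : Measure Ω)
    (F : Filtration ℝ≥0 mΩ) (X : ℝ≥0 → Ω → Fin 3 → ℝ) (m : Fin 3 → ℝ)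
    (S : Matrix (Fin 3) (Fin 3) ℝ) : Prop where
  adapted : ∀ t, Measurable[F t] (X t)
  start : ∀ ω, X 0 ω = 0
  cont : ∀ ω, Continuous fun t => X t ω
  indep : ∀ s t : ℝ≥0, s ≤ t →
    Indep (F s) (MeasurableSpace.comap (fun ω => X t ω - X s ω) inferInstance) Q
  law : ∀ s t : ℝ≥0, s ≤ t → ∀ a : Fin 3 → ℝ,
    Q.map (fun ω => a ⬝ᵥ (X t ω - X s ω)) =
      gaussianReal (((t : ℝ) - s) * (a ⬝ᵥ m)) (((t : ℝ) - s) * (a ⬝ᵥ S *ᵥ a)).toNNReal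

namespace CrisscrossData

/-- Drift of the Brownian motion in the Brownian control problem. -/
noncomputable def bmDrift {Ω : Type*} (N : CrisscrossData Ω) : Fin 3 → ℝ :=
  ![N.mu 0 * N.b 0, N.mu 1 * N.b 1, N.mu 2 * N.b 2 - N.mu 1 * N.b 1]

/-- Covariance matrix of the Brownian motion in the Brownian control problem. -/
noncomputable def bmCov {Ω : Type*} [MeasurableSpace Ω] (N : CrisscrossData Ω)
    (P : Measure Ω) : Matrix (Fin 3) (Fin 3) ℝ :=
  !![Var[N.u 0 0; P] * N.lam 0 + Var[N.v 0 0; P] * N.lam 0, 0, 0;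
     0, Var[N.u 1 0; P] * N.lam 1 + Var[N.v 1 0; P] * N.lam 1, -(Var[N.v 1 0; P] * N.lam 1);
     0, -(Var[N.v 1 0; P] * N.lam 1), Var[N.v 1 0; P] * N.lam 1 + Var[N.v 2 0; P] * N.mu 2]

/-- Cost rate of the workload control problem (value of the static linear program). -/
noncomputable def hhat {Ω : Type*} (N : CrisscrossData Ω) (w₁ w₂ : ℝ) : ℝ :=
  if N.mu 2 * w₂ ≤ N.mu 1 * w₁ then
    N.cost 0 * N.mu 0 * w₁ + N.mu 2 / N.mu 1 * (N.cost 1 * N.mu 1 - N.cost 0 * N.mu 0) * w₂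
  else
    (N.cost 1 * N.mu 1 - N.cost 2 * N.mu 1) * w₁ + N.cost 2 * N.mu 2 * w₂

/-- First workload coordinate started at `w₁`, driven by the Brownian motion path `x` and the
control `y`. -/
noncomputable def work₁ {Ω : Type*} (N : CrisscrossData Ω) (w₁ : ℝ) (x : Fin 3 → ℝ)
    (y : Fin 2 → ℝ) : ℝ :=
  w₁ + (x 0 / N.mu 0 + x 1 / N.mu 1) + y 0

/-- Second workload coordinate. -/
noncomputable def work₂ {Ω : Type*} (N : CrisscrossData Ω) (w₂ : ℝ) (x : Fin 3 → ℝ)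
    (y : Fin 2 → ℝ) : ℝ :=
  w₂ + (x 1 / N.mu 2 + x 2 / N.mu 2) + y 1

/-- `I` is an admissible control of the workload control problem started at `(w₁, w₂)`: an
adapted, right continuous, nonnegative, nondecreasing process (a jump at time zero is allowed)
which keeps both workload coordinates nonnegative. -/
structure IsAdmissibleIdle {Ω Ω' : Type*} {mΩ' : MeasurableSpace Ω'} (N : CrisscrossData Ω)
    (F : Filtration ℝ≥0 mΩ') (X : ℝ≥0 → Ω' → Fin 3 → ℝ) (w₁ w₂ : ℝ)
    (I : ℝ≥0 → Ω' → Fin 2 → ℝ) : Prop where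
  adapted : ∀ t, Measurable[F t] (I t)
  right_cont : ∀ ω t, ContinuousWithinAt (fun s => I s ω) (Ici t) t
  nonneg : ∀ ω t i, 0 ≤ I t ω i
  mono : ∀ ω i, Monotone fun t => I t ω i
  work₁_nonneg : ∀ ω t, 0 ≤ N.work₁ w₁ (X t ω) (I t ω)
  work₂_nonneg : ∀ ω t, 0 ≤ N.work₂ w₂ (X t ω) (I t ω)

/-- Value function of the workload control problem: the infimum of the expected discounted costs
over all admissible controls. -/
noncomputable def value {Ω : Type*} [MeasurableSpace Ω] (N : CrisscrossData Ω)
    (P : Measure Ω) (w₁ w₂ : ℝ) : ℝ :=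
  (sInf {J : ℝ≥0∞ | ∃ (Ω' : Type) (mΩ' : MeasurableSpace Ω') (Q : Measure Ω')
      (F : Filtration ℝ≥0 mΩ') (X : ℝ≥0 → Ω' → Fin 3 → ℝ) (I : ℝ≥0 → Ω' → Fin 2 → ℝ),
      IsProbabilityMeasure Q ∧ IsDriftedBM Q F X N.bmDrift (N.bmCov P) ∧
      N.IsAdmissibleIdle F X w₁ w₂ I ∧
      J = ∫⁻ ω, (∫⁻ t in Ici (0 : ℝ), ENNReal.ofReal (Real.exp (-N.disc * t) *
        N.hhat (N.work₁ w₁ (X t.toNNReal ω) (I t.toNNReal ω))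
          (N.work₂ w₂ (X t.toNNReal ω) (I t.toNNReal ω)))) ∂Q}).toReal

/-- The free boundary `Ψ(w₂) = sup {w₁ ≥ 0 : ∂_{w₁} J*(w₁, w₂) = 0}`, where the derivative at
`w₁ = 0` is one-sided. -/
noncomputable def freeBoundary {Ω : Type*} [MeasurableSpace Ω] (N : CrisscrossData Ω)
    (P : Measure Ω) (w₂ : ℝ) : ℝ :=
  sSup {w₁ : ℝ | 0 ≤ w₁ ∧ HasDerivWithinAt (fun x => N.value P x w₂) 0 (Ici 0) w₁}

/-! ### Primitive processes, queue lengths and workloads of the `n`-th network -/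

/-- Number of external arrivals of class `k` by time `t` in the `n`-th network. (The set is almost
surely bounded.) -/
noncomputable def arrivals {Ω : Type*} (N : CrisscrossData Ω) (n : ℕ) (k : Fin 2) (t : ℝ)
    (ω : Ω) : ℕ :=
  sSup {l : ℕ | ∑ i ∈ Finset.range l, N.u k i ω / N.lamN n k ≤ t}

/-- Number of service completions of class `j` after `t` units of service in the `n`-th network.
(The set is almost surely bounded.) -/
noncomputable def services {Ω : Type*} (N : CrisscrossData Ω) (n : ℕ) (j : Fin 3) (t : ℝ)
    (ω : Ω) : ℕ :=
  sSup {l : ℕ | ∑ i ∈ Finset.range l, N.v j i ω / N.muN n j ≤ t}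

/-- Queue lengths in the initially empty `n`-th network when `T j t ω` is the cumulative service
time devoted to class `j` during `[0, t]`. -/
noncomputable def queue {Ω : Type*} (N : CrisscrossData Ω) (n : ℕ) (T : Fin 3 → ℝ → Ω → ℝ)
    (t : ℝ) (ω : Ω) : Fin 3 → ℝ :=
  ![(N.arrivals n 0 t ω : ℝ) - N.services n 0 (T 0 t ω) ω,
    (N.arrivals n 1 t ω : ℝ) - N.services n 1 (T 1 t ω) ω,
    (N.services n 1 (T 1 t ω) ω : ℝ) - N.services n 2 (T 2 t ω) ω]

/-- Workload at server 1 of the queue length vector `q`. -/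
noncomputable def workload₁ {Ω : Type*} (N : CrisscrossData Ω) (n : ℕ) (q : Fin 3 → ℝ) : ℝ :=
  q 0 / N.muN n 0 + q 1 / N.muN n 1

/-- Workload at server 2 of the queue length vector `q`. -/
noncomputable def workload₂ {Ω : Type*} (N : CrisscrossData Ω) (n : ℕ) (q : Fin 3 → ℝ) : ℝ :=
  q 1 / N.muN n 2 + q 2 / N.muN n 2

/-! ### The threshold policy -/

/-- The threshold `Lⁿ = ⌊l₀ log n⌋`. -/
noncomputable def thrL (l₀ : ℝ) (n : ℕ) : ℝ := (⌊l₀ * Real.log n⌋ : ℤ)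

/-- The threshold `Cⁿ = ⌊c l₀ log n⌋`. -/
noncomputable def thrC (c l₀ : ℝ) (n : ℕ) : ℝ := (⌊c * l₀ * Real.log n⌋ : ℤ)

/-- The policy serves class `j` when the queue lengths are `q`. Server 1 (classes 1 and 2) works
according to the thresholds and the free boundary, and idles if neither of the first two clauses
applies; server 2 (class 3) works whenever buffer 3 is nonempty. -/
def Serves {Ω : Type*} [MeasurableSpace Ω] (N : CrisscrossData Ω) (P : Measure Ω)
    (c l₀ g₀ : ℝ) (n : ℕ) (q : Fin 3 → ℝ) : Fin 3 → Prop :=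
  ![0 < q 0 ∧
      ((q 2 - N.muN n 1 / N.muN n 0 * q 0 < thrL l₀ n ∧ (thrC c l₀ n - 1 ≤ q 2 ∨ q 1 = 0)) ∨
       (thrL l₀ n ≤ q 2 - N.muN n 1 / N.muN n 0 * q 0 ∧
          (N.muN n 0 / N.muN n 1 * (thrC c l₀ n - thrL l₀ n + 2) ≤ q 0 ∨ q 1 = 0))),
    0 < q 1 ∧
      ((q 2 - N.muN n 1 / N.muN n 0 * q 0 < thrL l₀ n ∧ q 2 < thrC c l₀ n - 1) ∨
       (thrL l₀ n ≤ q 2 - N.muN n 1 / N.muN n 0 * q 0 ∧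
          q 0 < N.muN n 0 / N.muN n 1 * (thrC c l₀ n - thrL l₀ n + 2) ∧
          g₀ ≤ N.workload₁ n q - √(n : ℝ) * N.freeBoundary P (N.workload₂ n q / √(n : ℝ)))),
    0 < q 2]

open Classical in
/-- The allocation process `T` is the one generated by the threshold policy in the `n`-th network:
almost surely, class `j` receives service at unit rate exactly while the policy serves it. -/
def FollowsPolicy {Ω : Type*} [MeasurableSpace Ω] (N : CrisscrossData Ω) (P : Measure Ω)
    (c l₀ g₀ : ℝ) (n : ℕ) (T : Fin 3 → ℝ → Ω → ℝ) : Prop :=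
  ∀ᵐ ω ∂P, ∀ j : Fin 3, ∀ t : ℝ, 0 ≤ t →
    T j t ω = ∫ s in (0 : ℝ)..t, if N.Serves P c l₀ g₀ n (N.queue n T s ω) j then 1 else 0

/-! ### Scaled processes -/

/-- Diffusion scaled idle time process of server 2 (constant on negative times). -/
noncomputable def scaledIdle₂ {Ω : Type*} (n : ℕ) (T : Fin 3 → ℝ → Ω → ℝ) (ω : Ω) (s : ℝ) : ℝ :=
  (n * max s 0 - T 2 (n * max s 0) ω) / √(n : ℝ)

/-- Diffusion scaled length of queue 2. -/
noncomputable def scaledQueue₂ {Ω : Type*} (N : CrisscrossData Ω) (n : ℕ)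
    (T : Fin 3 → ℝ → Ω → ℝ) (ω : Ω) (s : ℝ) : ℝ :=
  N.queue n T (n * s) ω 1 / √(n : ℝ)

end CrisscrossData

open Classical in
/-- Lebesgue–Stieltjes measure `df` of a nondecreasing function `f` (and `0` for other `f`). -/
noncomputable def stieltjesMeasure (f : ℝ → ℝ) : Measure ℝ :=
  if hf : Monotone f then hf.stieltjesFunction.measure else 0

namespace CrisscrossData

/-- The event that `∫_{[0,t)} 1_{B_d(n,s)} dÎ₂(s) ≠ 0`, where `B_d(n,s)` is the event that the scaled
queue 2 is at least `d l₀ log n / √n` at time `s`. -/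
noncomputable def idleEvent {Ω : Type*} (N : CrisscrossData Ω) (l₀ d : ℝ) (n : ℕ)
    (T : Fin 3 → ℝ → Ω → ℝ) (t : ℝ) : Set Ω :=
  {ω | ∫⁻ s in Ico 0 t,
      {s' : ℝ | d * l₀ * Real.log n / √(n : ℝ) ≤ N.scaledQueue₂ n T ω s'}.indicator
        (fun _ => (1 : ℝ≥0∞)) s ∂(stieltjesMeasure (scaledIdle₂ n T ω)) ≠ 0}

end CrisscrossData

/-! Server 2 idles only while buffer 3 is empty, so it suffices that, off an event of small
probability, buffer 3 is nonempty whenever buffer 2 holds at least `4K` customers, where `K = l₀ log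
n`.

Two facts force this. First, when buffer 2 is nonempty and buffer 3 is below `L - 1`, the policy
serves class 2 at full rate, whatever the free boundary is. Secondly, heavy traffic gives `λ₂ = μ₃ <
μ₂`, because class 1 takes a positive share of server 1. Hence buffer 3 tends to grow while it is
short and buffer 2 is nonempty.

Suppose that buffer 3 is empty and buffer 2 large at time `s`. Look back to the last time at which
buffer 2 was empty or buffer 3 was at least `L - 1`. Since then, either buffer 3 has lost about `K`
customers or buffer 2 has gained `4K`. In both cases order `K` class 3 services were completed, at
least as many as class 2 services, although class 2 was served all the time at the faster rate. This
is impossible if all long blocks of interarrival and service times have averages within `1 ± δ`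
(`downstream_pos_of_upstream_large`).

Chernoff bounds (`exists_block_tails`) and a union bound over blocks
(`measureReal_not_isTypical_le`) control the atypical paths. Blocks have length at least about
`K/4`, which gives a power of `n`; that the first `M`, of order `nt`, renewals outlast the horizon
costs a term exponential in `nt`.

Finally, the scaled idle time has a density vanishing while server 2 works, so its Stieltjes measure
does not charge those times (`stieltjesMeasure_zero_density`). This needs integrable service
indicators, which follows from the queue lengths being integers. -/

/-! ### Renewal counting functions -/

/-- The number of renewals by time `t` for the sequence `x` of interrenewal times. -/
noncomputable def renewalCount (x : ℕ → ℝ) (t : ℝ) : ℕ :=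
  sSup {l : ℕ | ∑ i ∈ Finset.range l, x i ≤ t}

section Renewal

variable {x : ℕ → ℝ} {R : ℝ} {M : ℕ}

theorem strictMono_partialSum (hx : ∀ i, 0 < x i) :
    StrictMono fun l => ∑ i ∈ Finset.range l, x i :=
  strictMono_nat_of_lt_succ fun l => by
    rw [Finset.sum_range_succ]; linarith [hx l]

/-- As the first `M` renewals outlast `R`, the set defining the count is bounded and its supremum is
attained. For an unbounded set `sSup` would have the default value `0`. -/
theorem le_renewalCount_iff (hx : ∀ i, 0 < x i) (hM : R < ∑ i ∈ Finset.range M, x i)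
    {t : ℝ} (h0 : 0 ≤ t) (ht : t ≤ R) (l : ℕ) :
    l ≤ renewalCount x t ↔ ∑ i ∈ Finset.range l, x i ≤ t := by
  have hmono := strictMono_partialSum hx
  have hbdd : BddAbove {l : ℕ | ∑ i ∈ Finset.range l, x i ≤ t} :=
    ⟨M, fun l hl => (hmono.lt_iff_lt.1 (lt_of_le_of_lt (le_trans hl ht) hM)).le⟩
  have hne : {l : ℕ | ∑ i ∈ Finset.range l, x i ≤ t}.Nonempty := ⟨0, by simpa using h0⟩
  refine ⟨fun h => ?_, fun h => le_csSup hbdd h⟩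
  exact le_trans (hmono.monotone h) (Nat.sSup_mem hne hbdd)

theorem renewalCount_lt_iff (hx : ∀ i, 0 < x i) (hM : R < ∑ i ∈ Finset.range M, x i)
    {t : ℝ} (h0 : 0 ≤ t) (ht : t ≤ R) (l : ℕ) :
    renewalCount x t < l ↔ t < ∑ i ∈ Finset.range l, x i := by
  rw [← not_le, le_renewalCount_iff hx hM h0 ht, not_le]

theorem renewalCount_mono (hx : ∀ i, 0 < x i) (hM : R < ∑ i ∈ Finset.range M, x i)
    {s t : ℝ} (h0 : 0 ≤ s) (hst : s ≤ t) (ht : t ≤ R) : renewalCount x s ≤ renewalCount x t := by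
  rw [le_renewalCount_iff hx hM (h0.trans hst) ht]
  exact le_trans ((le_renewalCount_iff hx hM h0 (hst.trans ht) _).1 le_rfl) hst

theorem renewalCount_zero (hx : ∀ i, 0 < x i) (hM : R < ∑ i ∈ Finset.range M, x i)
    (hR : 0 ≤ R) : renewalCount x 0 = 0 := by
  have : renewalCount x 0 < 1 := by
    rw [renewalCount_lt_iff hx hM le_rfl hR]; simpa using hx 0
  omega

theorem renewalCount_lt (hx : ∀ i, 0 < x i) (hM : R < ∑ i ∈ Finset.range M, x i)
    {t : ℝ} (h0 : 0 ≤ t) (ht : t ≤ R) : renewalCount x t < M :=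
  (renewalCount_lt_iff hx hM h0 ht M).2 (ht.trans_lt hM)

/-- A time window is shorter than the interrenewal times that cover it. -/
theorem window_lt_sum (hx : ∀ i, 0 < x i) (hM : R < ∑ i ∈ Finset.range M, x i)
    {s t : ℝ} (h0 : 0 ≤ s) (hst : s ≤ t) (ht : t ≤ R) {k : ℕ}
    (hk : renewalCount x t < renewalCount x s + k) :
    t - s < ∑ i ∈ Finset.range k, x (renewalCount x s + i) := by
  have h1 := (le_renewalCount_iff hx hM h0 (hst.trans ht) _).1 le_rfl
  have h2 := (renewalCount_lt_iff hx hM (h0.trans hst) ht _).1 hk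
  rw [Finset.sum_range_add] at h2
  linarith

/-- A time window is longer than the interrenewal times that it contains. -/
theorem sum_lt_window (hx : ∀ i, 0 < x i) (hM : R < ∑ i ∈ Finset.range M, x i)
    {s t : ℝ} (h0 : 0 ≤ s) (hst : s ≤ t) (ht : t ≤ R) {k : ℕ}
    (hk : renewalCount x s + 1 + k ≤ renewalCount x t) :
    ∑ i ∈ Finset.range k, x (renewalCount x s + 1 + i) < t - s := by
  -- The renewal in progress at time `s` is only partly inside the window; it is discarded, so the
  -- block starts one index later.
  have h1 := (renewalCount_lt_iff hx hM h0 (hst.trans ht) _).1 (Nat.lt_succ_self _)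
  have h2 := (le_renewalCount_iff hx hM (h0.trans hst) ht _).1 hk
  rw [Finset.sum_range_add] at h2
  simp only [Nat.succ_eq_add_one] at h1
  linarith

/-- Clamping to `[0, R]` makes the count monotone on the whole line, hence measurable. -/
theorem monotone_renewalCount_clamp (hx : ∀ i, 0 < x i) (hM : R < ∑ i ∈ Finset.range M, x i)
    (hR : 0 ≤ R) : Monotone fun t => renewalCount x (max 0 (min t R)) := by
  intro s t hst
  exact renewalCount_mono hx hM (le_max_left _ _) (by gcongr) (max_le hR (min_le_right _ _))

end Renewal

/-! ### Allocation processes -/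

section Allocation

variable {g : ℝ → ℝ} {R : ℝ}

/-- Integrability is not needed, since the default value `0` of the integral also lies in the
interval. Thus allocations can be bounded before the service indicators are known to be integrable.
-/
theorem integral_mem_Icc (hg : ∀ s, g s = 0 ∨ g s = 1) {t : ℝ} (ht : 0 ≤ t) :
    (∫ s in (0 : ℝ)..t, g s) ∈ Icc 0 t := by
  refine ⟨intervalIntegral.integral_nonneg ht fun s _ => ?_, ?_⟩
  · rcases hg s with h | h <;> simp [h]
  · refine (le_abs_self _).trans ?_
    have := intervalIntegral.norm_integral_le_of_norm_le_const (a := 0) (b := t) (f := g) (C := 1)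
      fun s _ => by rcases hg s with h | h <;> simp [h]
    simpa [abs_of_nonneg ht] using this

theorem integral_sub_mem_Icc (hg : ∀ s, g s = 0 ∨ g s = 1)
    (hi : IntervalIntegrable g volume 0 R) {r s : ℝ} (h0 : 0 ≤ r) (hrs : r ≤ s) (hs : s ≤ R) :
    (∫ z in (0 : ℝ)..s, g z) - (∫ z in (0 : ℝ)..r, g z) ∈ Icc 0 (s - r) := by
  have hint : ∀ t, 0 ≤ t → t ≤ R → IntervalIntegrable g volume 0 t := fun t h1 h2 =>
    hi.mono_set (by rw [uIcc_of_le h1, uIcc_of_le (h1.trans h2)]; exact Icc_subset_Icc_right h2)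
  rw [intervalIntegral.integral_interval_sub_left (hint s (h0.trans hrs) hs)
    (hint r h0 (hrs.trans hs))]
  refine ⟨intervalIntegral.integral_nonneg hrs fun s _ => ?_, ?_⟩
  · rcases hg s with h | h <;> simp [h]
  · refine (le_abs_self _).trans ?_
    have := intervalIntegral.norm_integral_le_of_norm_le_const (a := r) (b := s) (f := g) (C := 1)
      fun s _ => by rcases hg s with h | h <;> simp [h]
    simpa [abs_of_nonneg (sub_nonneg.2 hrs)] using this

theorem integral_sub_eq_of_eqOn (hi : IntervalIntegrable g volume 0 R) {r s : ℝ} (h0 : 0 ≤ r)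
    (hrs : r ≤ s) (hs : s ≤ R) {a : ℝ} (ha : ∀ z ∈ Ioc r s, g z = a) :
    (∫ z in (0 : ℝ)..s, g z) - (∫ z in (0 : ℝ)..r, g z) = (s - r) * a := by
  have hint : ∀ t, 0 ≤ t → t ≤ R → IntervalIntegrable g volume 0 t := fun t h1 h2 =>
    hi.mono_set (by rw [uIcc_of_le h1, uIcc_of_le (h1.trans h2)]; exact Icc_subset_Icc_right h2)
  rw [intervalIntegral.integral_interval_sub_left (hint s (h0.trans hrs) hs)
    (hint r h0 (hrs.trans hs)), intervalIntegral.integral_congr_ae (g := fun _ => a)]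
  · simp
  · rw [uIoc_of_le hrs]; exact Eventually.of_forall ha

theorem continuousOn_allocation (hg : ∀ s, g s = 0 ∨ g s = 1)
    (hi : IntervalIntegrable g volume 0 R) :
    ContinuousOn (fun s => ∫ z in (0 : ℝ)..s, g z) (Icc 0 R) := by
  have : LipschitzOnWith 1 (fun s => ∫ z in (0 : ℝ)..s, g z) (Icc 0 R) := by
    refine LipschitzOnWith.of_le_add fun s hs r hr => ?_
    rcases le_total r s with h | h
    · have := (integral_sub_mem_Icc hg hi hr.1 h hs.2).2
      rw [Real.dist_eq, abs_of_nonneg (sub_nonneg.2 h)]; linarith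
    · have := (integral_sub_mem_Icc hg hi hs.1 h hr.2).1
      have h2 := dist_nonneg (x := s) (y := r)
      linarith
  exact this.continuousOn

/-- A buffer that is not served while empty never becomes negative. -/
theorem departures_le_arrivals {x : ℕ → ℝ} {M : ℕ} (hx : ∀ i, 0 < x i)
    (hM : R < ∑ i ∈ Finset.range M, x i) (hg : ∀ s, g s = 0 ∨ g s = 1)
    (hi : IntervalIntegrable g volume 0 R) {arr : ℝ → ℕ}
    (harr : ∀ r s, 0 ≤ r → r ≤ s → s ≤ R → arr r ≤ arr s)
    (hidle : ∀ s, 0 ≤ s → s ≤ R → arr s ≤ renewalCount x (∫ z in (0 : ℝ)..s, g z) → g s = 0)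
    {s : ℝ} (h0 : 0 ≤ s) (hs : s ≤ R) :
    renewalCount x (∫ z in (0 : ℝ)..s, g z) ≤ arr s := by
  by_contra! hlt
  have hmem : ∀ t, 0 ≤ t → t ≤ R → 0 ≤ (∫ z in (0 : ℝ)..t, g z) ∧ (∫ z in (0 : ℝ)..t, g z) ≤ R :=
    fun t h1 h2 => ⟨(integral_mem_Icc hg h1).1, (integral_mem_Icc hg h1).2.trans h2⟩
  have hT := (le_renewalCount_iff hx hM (hmem s h0 hs).1 (hmem s h0 hs).2 (arr s + 1)).1 hlt
  have hlt' := strictMono_partialSum hx (Nat.lt_succ_self (arr s))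
  simp only [Nat.succ_eq_add_one] at hlt'
  have hpos : 0 ≤ ∑ i ∈ Finset.range (arr s), x i := Finset.sum_nonneg fun i _ => (hx i).le
  -- Let `r` be a time at which the allocation completes service number `arr s`. From then on up to
  -- `s` the buffer counts as empty, so the allocation is frozen and the next service cannot be
  -- completed by `s`.
  obtain ⟨r, hr, hrT⟩ := intermediate_value_Icc h0
    ((continuousOn_allocation hg hi).mono (Icc_subset_Icc_right hs))
    (show (∑ i ∈ Finset.range (arr s), x i) ∈ Icc (∫ z in (0 : ℝ)..0, g z) (∫ z in (0 : ℝ)..s, g z)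
      from ⟨by simpa using hpos, hlt'.le.trans hT⟩)
  have hconst := integral_sub_eq_of_eqOn (a := 0) hi hr.1 hr.2 hs fun z hz => by
    have hz0 := hr.1.trans hz.1.le
    have hzR := hz.2.trans hs
    refine hidle z hz0 hzR ((harr z s hz0 hz.2 hs).trans ?_)
    rw [le_renewalCount_iff hx hM (hmem z hz0 hzR).1 (hmem z hz0 hzR).2, ← hrT]
    have := (integral_sub_mem_Icc hg hi hr.1 hz.1.le hzR).1
    simp only at this ⊢
    linarith
  simp only at hrT
  linarith

end Allocation

/-! ### Pathwise argument: buffer 3 does not run empty while buffer 2 is long -/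

set_option maxHeartbeats 1000000 in
/-- If buffer 2 is served at full rate whenever it is nonempty and buffer 3 is short, and all long
stretches of interarrival and service times are typical, then buffer 3 is nonempty whenever
buffer 2 is long. -/
theorem downstream_pos_of_upstream_large {xa x2 x3 : ℕ → ℝ} {R : ℝ} {M k₀ : ℕ}
    {g2 g3 : ℝ → ℝ} {lam mu2 mu3 δ K ℓ : ℝ}
    (hxa : ∀ i, 0 < xa i) (hx2 : ∀ i, 0 < x2 i) (hx3 : ∀ i, 0 < x3 i)
    (hMa : R < ∑ i ∈ Finset.range M, xa i) (hM2 : R < ∑ i ∈ Finset.range M, x2 i)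
    (hM3 : R < ∑ i ∈ Finset.range M, x3 i)
    (hg2 : ∀ s, g2 s = 0 ∨ g2 s = 1) (hg3 : ∀ s, g3 s = 0 ∨ g3 s = 1)
    (hi2 : IntervalIntegrable g2 volume 0 R) (hi3 : IntervalIntegrable g3 volume 0 R)
    (hq3 : ∀ s, 0 ≤ s → s ≤ R → renewalCount x3 (∫ z in (0 : ℝ)..s, g3 z) ≤
      renewalCount x2 (∫ z in (0 : ℝ)..s, g2 z))
    (hserve : ∀ s, 0 ≤ s → s ≤ R →
      (0 : ℝ) < renewalCount xa s - renewalCount x2 (∫ z in (0 : ℝ)..s, g2 z) →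
      (renewalCount x2 (∫ z in (0 : ℝ)..s, g2 z) : ℝ) -
        renewalCount x3 (∫ z in (0 : ℝ)..s, g3 z) < ℓ → g2 s = 1)
    (hlam : 0 < lam) (hmu2 : 0 < mu2) (hmu3 : 0 < mu3) (hδ : 0 < δ) (hδ' : δ ≤ 1 / 8)
    (hrate : (1 + δ) * mu3 ≤ (1 - 2 * δ) * mu2) (hlm : lam ≤ 2 * mu3)
    (hta : ∀ m k, m ≤ M → k₀ ≤ k → k ≤ M + 1 →
      (1 - δ) * k / lam ≤ ∑ i ∈ Finset.range k, xa (m + i))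
    (ht2 : ∀ m k, m ≤ M → k₀ ≤ k → k ≤ M + 1 →
      ∑ i ∈ Finset.range k, x2 (m + i) ≤ (1 + δ) * k / mu2)
    (ht3 : ∀ m k, m ≤ M → k₀ ≤ k → k ≤ M + 1 →
      (1 - δ) * k / mu3 ≤ ∑ i ∈ Finset.range k, x3 (m + i))
    (hk₀ : 3 ≤ δ * k₀) (hk₀K : (k₀ : ℝ) ≤ K / 4 + 1) (hℓ : K - 2 ≤ ℓ)
    {s : ℝ} (h0 : 0 ≤ s) (hs : s ≤ R)
    (hlarge : 4 * K ≤ (renewalCount xa s : ℝ) - renewalCount x2 (∫ z in (0 : ℝ)..s, g2 z)) :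
    renewalCount x3 (∫ z in (0 : ℝ)..s, g3 z) < renewalCount x2 (∫ z in (0 : ℝ)..s, g2 z) := by
  by_contra! hempty
  set T2 : ℝ → ℝ := fun s => ∫ z in (0 : ℝ)..s, g2 z with hT2
  set T3 : ℝ → ℝ := fun s => ∫ z in (0 : ℝ)..s, g3 z with hT3
  have hR : 0 ≤ R := h0.trans hs
  have e2 : ∀ s, (∫ z in (0 : ℝ)..s, g2 z) = T2 s := fun _ => rfl
  have e3 : ∀ s, (∫ z in (0 : ℝ)..s, g3 z) = T3 s := fun _ => rfl
  simp only [e2, e3] at hempty hlarge hq3 hserve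
  have hmem2 : ∀ t, 0 ≤ t → t ≤ R → 0 ≤ T2 t ∧ T2 t ≤ R := fun t h1 h2 =>
    ⟨(integral_mem_Icc hg2 h1).1, (integral_mem_Icc hg2 h1).2.trans h2⟩
  have hmem3 : ∀ t, 0 ≤ t → t ≤ R → 0 ≤ T3 t ∧ T3 t ≤ R := fun t h1 h2 =>
    ⟨(integral_mem_Icc hg3 h1).1, (integral_mem_Icc hg3 h1).2.trans h2⟩
  -- The times up to `s` at which full-rate service of class 2 is not guaranteed; `0` is one of them
  -- because the network starts empty.
  set E : Set ℝ := {r | 0 ≤ r ∧ r ≤ s ∧ ((renewalCount xa r : ℝ) - renewalCount x2 (T2 r) ≤ 0 ∨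
    ℓ ≤ (renewalCount x2 (T2 r) : ℝ) - renewalCount x3 (T3 r))} with hE
  have hE0 : (0 : ℝ) ∈ E := ⟨le_rfl, h0, Or.inl (by simp [renewalCount_zero hxa hMa hR])⟩
  have hEb : BddAbove E := ⟨s, fun r hr => hr.2.1⟩
  set a := sSup E with ha
  have ha0 : 0 ≤ a := le_csSup hEb hE0
  have has : a ≤ s := csSup_le ⟨0, hE0⟩ fun r hr => hr.2.1
  have hη : 0 < 1 / mu3 := by positivity
  -- The supremum `a` need not belong to `E`. A point `r` of `E` within `1 / mu3` of it costs only
  -- an additive `1` in units of class 3 services.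
  obtain ⟨r, hrE, hra⟩ := exists_lt_of_lt_csSup ⟨0, hE0⟩ (show a - 1 / mu3 < sSup E by
    rw [← ha]; linarith)
  have hra' : r ≤ a := le_csSup hEb hrE
  obtain ⟨hr0, hrs, hr⟩ := hrE
  have hrR := hrs.trans hs
  have hfull : T2 s - T2 a = (s - a) * 1 := integral_sub_eq_of_eqOn hi2 ha0 has hs fun z hz => by
    have hz0 := ha0.trans hz.1.le
    have hzE : z ∉ E := notMem_of_csSup_lt hz.1 hEb
    have hz' : ¬((renewalCount xa z : ℝ) - renewalCount x2 (T2 z) ≤ 0 ∨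
        ℓ ≤ (renewalCount x2 (T2 z) : ℝ) - renewalCount x3 (T3 z)) :=
      fun h => hzE ⟨hz0, hz.2, h⟩
    push Not at hz'
    exact hserve z hz0 (hz.2.trans hs) hz'.1 hz'.2
  have hT2ar : 0 ≤ T2 a - T2 r := (integral_sub_mem_Icc hg2 hi2 hr0 hra' (has.trans hs)).1
  have hT2sr : 0 ≤ T2 s - T2 r := (integral_sub_mem_Icc hg2 hi2 hr0 hrs hs).1
  have hT3sr := integral_sub_mem_Icc hg3 hi3 hr0 hrs hs
  rw [e3, e3] at hT3sr
  obtain ⟨hT30, hT31⟩ := hT3sr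
  have hlen : s - r < T2 s - T2 r + 1 / mu3 := by linarith
  obtain ⟨D2, hD2⟩ := Nat.exists_eq_add_of_le (renewalCount_mono hx2 hM2 (hmem2 r hr0 hrR).1
    (sub_nonneg.1 hT2sr) (hmem2 s h0 hs).2)
  obtain ⟨D3, hD3⟩ := Nat.exists_eq_add_of_le (renewalCount_mono hx3 hM3 (hmem3 r hr0 hrR).1
    (sub_nonneg.1 hT30) (hmem3 s h0 hs).2)
  obtain ⟨A, hA⟩ := Nat.exists_eq_add_of_le (renewalCount_mono hxa hMa hr0 hrs hs)
  have hb2 := renewalCount_lt hx2 hM2 (hmem2 s h0 hs).1 (hmem2 s h0 hs).2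
  have hb3 := renewalCount_lt hx3 hM3 (hmem3 s h0 hs).1 (hmem3 s h0 hs).2
  have hba := renewalCount_lt hxa hMa h0 hs
  have hq3r := hq3 r hr0 hrR
  -- Buffer 3 is nonnegative at `r` and empty at `s`, so over the window its departures are at least
  -- its arrivals.
  have hD23 : D2 ≤ D3 := by omega
  -- Class 2 is in service for all but `1 / mu3` of the window, and `D2 + 1` of its services cover
  -- that time. The block is lengthened to `k₀` if necessary, so that typicality applies.
  have hwin2 : k₀ ≤ M + 1 → (s - r) * mu3 < (1 - 2 * δ) * (max (D2 + 1) k₀ : ℕ) + 1 := by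
    intro hkM
    have h1 := window_lt_sum hx2 hM2 (hmem2 r hr0 hrR).1 (sub_nonneg.1 hT2sr) (hmem2 s h0 hs).2
      (k := max (D2 + 1) k₀) (by have := le_max_left (D2 + 1) k₀; omega)
    have h2 := ht2 (renewalCount x2 (T2 r)) (max (D2 + 1) k₀) (by omega) (le_max_right _ _)
      (max_le (by omega) hkM)
    have h3 : (1 + δ) * (max (D2 + 1) k₀ : ℕ) / mu2 * mu3 ≤ (1 - 2 * δ) * (max (D2 + 1) k₀ : ℕ) := by
      rw [div_mul_eq_mul_div, div_le_iff₀ hmu2]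
      linarith [mul_le_mul_of_nonneg_right hrate (Nat.cast_nonneg (α := ℝ) (max (D2 + 1) k₀))]
    have h4 : s - r < (1 + δ) * (max (D2 + 1) k₀ : ℕ) / mu2 + 1 / mu3 := by linarith
    have h5 := mul_lt_mul_of_pos_right h4 hmu3
    rw [add_mul, one_div_mul_cancel hmu3.ne'] at h5
    linarith
  have hk₀' : (24 : ℝ) ≤ k₀ := by
    linarith [mul_le_mul_of_nonneg_right hδ' (Nat.cast_nonneg (α := ℝ) k₀)]
  -- The window contains enough class 3 services for a typical block. If buffer 2 was empty at `r`,
  -- its `4K` arrivals make the window long, which forces many class 2 services and so many class 3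
  -- services. If buffer 3 was at least `ℓ`, it had to be drained.
  have hD3k : k₀ + 1 ≤ D3 := by
    rcases hr with hr | hr
    · have hAK : 4 * K ≤ A := by
        have : (renewalCount xa s : ℝ) = renewalCount xa r + A := by exact_mod_cast hA
        have h2 : (renewalCount x2 (T2 s) : ℝ) = renewalCount x2 (T2 r) + D2 := by
          exact_mod_cast hD2
        have h3 : (0 : ℝ) ≤ D2 := Nat.cast_nonneg _
        linarith
      have hAk : k₀ + 1 ≤ A := by
        have : (k₀ : ℝ) + 1 ≤ A := by linarith
        exact_mod_cast this
      obtain ⟨k, rfl⟩ := Nat.exists_eq_add_of_le' (le_trans (by omega : 1 ≤ k₀ + 1) hAk)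
      have h1 := sum_lt_window hxa hMa hr0 hrs hs (k := k) (by omega)
      have h2 := hta (renewalCount xa r + 1) k (by omega) (by omega) (by omega)
      have h3 : (1 - δ) * k / lam < s - r := by linarith
      rw [div_lt_iff₀ hlam] at h3
      have h4 := hwin2 (by omega)
      push_cast at hAK
      have h5 : (s - r) * lam ≤ 2 * ((s - r) * mu3) := by
        linarith [mul_le_mul_of_nonneg_left hlm (sub_nonneg.2 hrs)]
      have h6 : (1 - 2 * δ) * (max (D2 + 1) k₀ : ℕ) ≤ (max (D2 + 1) k₀ : ℕ) :=
        mul_le_of_le_one_left (Nat.cast_nonneg _) (by linarith)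
      have h7 : (7 / 8 : ℝ) * k ≤ (1 - δ) * k :=
        mul_le_mul_of_nonneg_right (by linarith) (Nat.cast_nonneg _)
      have h8 : (k₀ : ℝ) + 2 < (max (D2 + 1) k₀ : ℕ) := by linarith
      have h9 : k₀ + 2 < max (D2 + 1) k₀ := by exact_mod_cast h8
      rcases max_cases (D2 + 1) k₀ with h | h <;> omega
    · have h2 : (renewalCount x2 (T2 s) : ℝ) = renewalCount x2 (T2 r) + D2 := by
        exact_mod_cast hD2
      have h3 : (renewalCount x3 (T3 s) : ℝ) = renewalCount x3 (T3 r) + D3 := by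
        exact_mod_cast hD3
      have h4 : (renewalCount x2 (T2 s) : ℝ) ≤ renewalCount x3 (T3 s) := by exact_mod_cast hempty
      have h5 : (0 : ℝ) ≤ D2 := Nat.cast_nonneg _
      have : (k₀ : ℝ) + 1 ≤ D3 := by linarith
      exact_mod_cast this
  obtain ⟨k, rfl⟩ := Nat.exists_eq_add_of_le' (le_trans (by omega : 1 ≤ k₀ + 1) hD3k)
  have h1 := sum_lt_window hx3 hM3 (hmem3 r hr0 hrR).1 (sub_nonneg.1 hT30) (hmem3 s h0 hs).2
    (k := k) (by omega)
  have h2 := ht3 (renewalCount x3 (T3 r) + 1) k (by omega) (by omega) (by omega)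
  have h3 : (1 - δ) * k / mu3 < s - r := by linarith
  rw [div_lt_iff₀ hmu3] at h3
  have h4 := hwin2 (by omega)
  have h5 : ((max (D2 + 1) k₀ : ℕ) : ℝ) ≤ k + 2 := by
    have : max (D2 + 1) k₀ ≤ k + 2 := max_le (by omega) (by omega)
    exact_mod_cast this
  have h6 : (k₀ : ℝ) ≤ k := by exact_mod_cast (by omega : k₀ ≤ k)
  -- With `k = D3 - 1`, the bounds combine to `(1 - δ) k < (1 - 2δ)(k + 2) + 1`, that is `δ k < 3 -
  -- 4δ`, against `3 ≤ δ k₀ ≤ δ k`.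
  linarith [mul_le_mul_of_nonneg_left h5 (by linarith : 0 ≤ 1 - 2 * δ),
    mul_le_mul_of_nonneg_left h6 hδ.le]

/-! ### Exponential bounds for sums of i.i.d. random variables -/

section Chernoff

variable {Ω : Type*} [MeasurableSpace Ω] {P : Measure Ω} [IsProbabilityMeasure P]

/-- Some positive exponential tilt makes the moment generating function smaller than the
exponential with a strictly larger slope than the mean. -/
theorem exists_mgf_lt {Y : Ω → ℝ} {a : ℝ} (h0 : (0 : ℝ) ∈ interior (integrableExpSet Y P))
    (hmean : ∫ ω, Y ω ∂P < a) :
    ∃ s > 0, s ∈ integrableExpSet Y P ∧ mgf Y P s < Real.exp (s * a) := by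
  -- The difference vanishes at `0` with negative derivative, so it is negative for small positive
  -- `s`.
  have hd : HasDerivAt (fun s => mgf Y P s - Real.exp (s * a)) ((∫ ω, Y ω ∂P) - a) 0 := by
    have h1 := hasDerivAt_mgf h0
    have h2 : HasDerivAt (fun s : ℝ => Real.exp (s * a)) a 0 := by
      simpa using ((hasDerivAt_id (0 : ℝ)).mul_const a).exp
    exact (h1.sub h2).congr_deriv (by simp)
  have hslope := hd.tendsto_slope_zero_right
  have hneg := hslope.eventually (gt_mem_nhds (sub_neg.2 hmean))
  have hint : ∀ᶠ s in 𝓝[>] (0 : ℝ), s ∈ integrableExpSet Y P :=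
    nhdsWithin_le_nhds (mem_interior_iff_mem_nhds.1 h0)
  obtain ⟨s, hs1, hs2, hs3⟩ := (hneg.and (hint.and self_mem_nhdsWithin)).exists
  refine ⟨s, hs3, hs2, ?_⟩
  have hs3' : 0 < s := hs3
  simp only [zero_add, mgf_zero, zero_mul, Real.exp_zero, sub_self, sub_zero, smul_eq_mul] at hs1
  have := (mul_neg_iff.1 hs1).resolve_right (fun h => absurd h.1 (not_lt.2 (inv_pos.2 hs3').le))
  linarith [this.2]

/-- Chernoff bound for the upper tail of blocks of an i.i.d. sequence. -/
theorem exists_upper_tail {X : ℕ → Ω → ℝ} (hmeas : ∀ i, Measurable (X i)) (hind : iIndepFun X P)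
    (hid : ∀ i, IdentDistrib (X i) (X 0) P P)
    (h0 : (0 : ℝ) ∈ interior (integrableExpSet (X 0) P)) {a : ℝ} (hmean : ∫ ω, X 0 ω ∂P < a) :
    ∃ θ > 0, ∀ m k : ℕ,
      P.real {ω | a * k ≤ ∑ i ∈ Finset.range k, X (m + i) ω} ≤ Real.exp (-θ * k) := by
  obtain ⟨s, hs, hsi, hlt⟩ := exists_mgf_lt h0 hmean
  have hpos : 0 < mgf (X 0) P s := mgf_pos hsi
  -- The exponent that Markov's inequality gives for the tilt `s`.
  refine ⟨s * a - Real.log (mgf (X 0) P s), ?_, fun m k => ?_⟩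
  · have := (Real.log_lt_iff_lt_exp hpos).2 hlt
    simpa using this
  have hind' : iIndepFun (fun i => X (m + i)) P := hind.precomp (add_right_injective m)
  have hint : ∀ i, Integrable (fun ω => Real.exp (s * X i ω)) P := fun i =>
    (((hid i).comp (u := fun x => Real.exp (s * x)) (by fun_prop)).integrable_iff).2 hsi
  have hints : Integrable (fun ω => Real.exp (s * (∑ i ∈ Finset.range k, X (m + i)) ω)) P :=
    hind'.integrable_exp_mul_sum (fun i => hmeas _) fun i _ => hint _
  have h1 := measure_ge_le_exp_mul_mgf (X := ∑ i ∈ Finset.range k, X (m + i)) (a * k) hs.le hints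
  have hm : ∀ i, mgf (X (m + i)) P s = mgf (X 0) P s := fun i => by
    rw [mgf_congr_identDistrib (hid (m + i))]
  rw [hind'.mgf_sum (fun i => hmeas _), Finset.prod_congr rfl fun i _ => hm i,
    Finset.prod_const, Finset.card_range] at h1
  simp only [Finset.sum_apply] at h1
  refine h1.trans (le_of_eq ?_)
  conv_lhs => rw [← Real.exp_log hpos, ← Real.exp_nat_mul, ← Real.exp_add]
  congr 1
  ring

/-- Two-sided Chernoff bound for blocks of an i.i.d. sequence with mean one. -/
theorem exists_block_tails {X : ℕ → Ω → ℝ} (hmeas : ∀ i, Measurable (X i)) (hind : iIndepFun X P)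
    (hid : ∀ i, IdentDistrib (X i) (X 0) P P)
    (h0 : (0 : ℝ) ∈ interior (integrableExpSet (X 0) P)) (hmean : ∫ ω, X 0 ω ∂P = 1)
    {δ : ℝ} (hδ : 0 < δ) :
    ∃ θ > 0, ∀ m k : ℕ,
      P.real {ω | (1 + δ) * k ≤ ∑ i ∈ Finset.range k, X (m + i) ω} ≤ Real.exp (-θ * k) ∧
      P.real {ω | ∑ i ∈ Finset.range k, X (m + i) ω ≤ (1 - δ) * k} ≤ Real.exp (-θ * k) := by
  obtain ⟨θ₁, hθ₁, h₁⟩ := exists_upper_tail hmeas hind hid h0 (a := 1 + δ) (by linarith)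
  have h0' : (0 : ℝ) ∈ interior (integrableExpSet (fun ω => -X 0 ω) P) := by
    rw [mem_interior_iff_mem_nhds] at h0 ⊢
    have : Tendsto (fun s : ℝ => -s) (𝓝 0) (𝓝 0) := by simpa using (tendsto_id (x := 𝓝 (0:ℝ))).neg
    filter_upwards [this h0] with s hs
    have hs' : Integrable (fun ω => Real.exp (-s * X 0 ω)) P := hs
    change Integrable (fun ω => Real.exp (s * -X 0 ω)) P
    simpa using hs'
  obtain ⟨θ₂, hθ₂, h₂⟩ := exists_upper_tail (X := fun i ω => -X i ω) (fun i => (hmeas i).neg)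
    (hind.comp (fun _ x => -x) fun _ => measurable_neg)
    (fun i => (hid i).comp measurable_neg) h0' (a := -(1 - δ))
    (by rw [integral_neg]; linarith)
  refine ⟨min θ₁ θ₂, lt_min hθ₁ hθ₂, fun m k => ⟨(h₁ m k).trans ?_, ?_⟩⟩
  · have := mul_le_mul_of_nonneg_right (min_le_left θ₁ θ₂) (Nat.cast_nonneg (α := ℝ) k)
    exact Real.exp_le_exp.2 (by linarith)
  · have := mul_le_mul_of_nonneg_right (min_le_right θ₁ θ₂) (Nat.cast_nonneg (α := ℝ) k)
    refine le_trans (le_of_eq ?_) ((h₂ m k).trans (Real.exp_le_exp.2 (by linarith)))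
    congr 1
    ext ω
    simp only [Set.mem_ofPred_eq, Finset.sum_neg_distrib]
    constructor <;> intro h <;> linarith

end Chernoff

/-! ### Lebesgue–Stieltjes measures of absolutely continuous functions -/

/-- The Lebesgue–Stieltjes measure of a function with density `h` on `[0, t]` does not charge the
zero set of `h` in `[0, t)`. -/
theorem stieltjesMeasure_zero_density {f h : ℝ → ℝ} {t : ℝ} (hf0 : ∀ s ≤ 0, f s = 0)
    (hf : ∀ s ∈ Icc 0 t, f s = ∫ z in (0 : ℝ)..s, h z) (hh : ∀ s, 0 ≤ h s)
    (hi : IntervalIntegrable h volume 0 t) :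
    stieltjesMeasure f {s | s ∈ Ico 0 t ∧ h s = 0} = 0 := by
  by_cases hmono : Monotone f
  swap
  · simp [stieltjesMeasure, hmono]
  rcases le_or_gt t 0 with ht | ht
  · have : {s | s ∈ Ico 0 t ∧ h s = 0} = ∅ := by
      ext s
      simp only [mem_ofPred_eq, mem_Ico, mem_empty_iff_false, iff_false]
      rintro ⟨⟨h1, h2⟩, -⟩
      linarith
    rw [this, measure_empty]
  have hint : ∀ s, 0 ≤ s → s ≤ t → IntervalIntegrable h volume 0 s := fun s h1 h2 =>
    hi.mono_set (by rw [uIcc_of_le h1, uIcc_of_le (h1.trans h2)]; exact Icc_subset_Icc_right h2)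
  have hcont : ContinuousOn f (Icc 0 t) := by
    refine ContinuousOn.congr ?_ hf
    have := intervalIntegral.continuousOn_primitive_interval
      (μ := volume) (f := h) (a := 0) (b := t)
      (by rw [uIcc_of_le ht.le]; exact (intervalIntegrable_iff_integrableOn_Icc_of_le ht.le).1 hi)
    rwa [uIcc_of_le ht.le] at this
  -- Half-open intervals `[a, b)` are used because they involve only left limits at points of `[0,
  -- t]`: nothing is known about `f` beyond `t`, while `f = 0` on the left of `0` excludes an atom
  -- there.
  have hleft : ∀ s, 0 ≤ s → s ≤ t → Function.leftLim hmono.stieltjesFunction s = f s := by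
    intro s h0 hs
    have h1 : Function.leftLim hmono.stieltjesFunction s = Function.leftLim f s :=
      leftLim_rightLim (hmono.tendsto_leftLim s)
    rw [h1]
    refine leftLim_eq_of_tendsto ?_
    rcases h0.eq_or_lt with rfl | h0
    · rw [hf0 0 le_rfl]
      refine tendsto_const_nhds.congr' ?_
      filter_upwards [self_mem_nhdsWithin] with z hz using (hf0 z (le_of_lt hz)).symm
    · refine ((hcont s ⟨h0.le, hs⟩).mono_of_mem_nhdsWithin ?_).tendsto
      exact mem_of_superset (Ioo_mem_nhdsLT h0) fun z hz => ⟨hz.1.le, hz.2.le.trans hs⟩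
  set H : ℝ → ℝ := (Ico 0 t).indicator h with hH
  have hHi : Integrable H := by
    rw [hH, integrable_indicator_iff measurableSet_Ico]
    exact ((intervalIntegrable_iff_integrableOn_Icc_of_le ht.le).1 hi).mono_set Ico_subset_Icc_self
  have hH0 : ∀ s, 0 ≤ H s := fun s => indicator_nonneg (fun s _ => hh s) s
  have hmeas : (stieltjesMeasure f).restrict (Ico 0 t) =
      volume.withDensity fun s => ENNReal.ofReal (H s) := by
    rw [stieltjesMeasure, dif_pos hmono]
    refine Measure.ext_of_Ico _ _ fun a b _ => ?_
    rw [Measure.restrict_apply measurableSet_Ico, withDensity_apply _ measurableSet_Ico,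
      ← ofReal_integral_eq_lintegral_ofReal hHi.integrableOn (Eventually.of_forall hH0), hH,
      setIntegral_indicator measurableSet_Ico, Ico_inter_Ico]
    rcases le_or_gt (b ⊓ t) (a ⊔ 0) with hab | hab
    · simp [Ico_eq_empty_of_le hab]
    have ha : 0 ≤ a ⊔ 0 := le_max_right _ _
    have hb : b ⊓ t ≤ t := min_le_right _ _
    rw [StieltjesFunction.measure_Ico, hleft _ (ha.trans hab.le) hb, hleft _ ha (hab.le.trans hb),
      hf _ ⟨ha.trans hab.le, hb⟩, hf _ ⟨ha, hab.le.trans hb⟩,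
      intervalIntegral.integral_interval_sub_left (hint _ (ha.trans hab.le) hb)
        (hint _ ha (hab.le.trans hb)),
      intervalIntegral.integral_of_le hab.le, integral_Ico_eq_integral_Ioc]
  have hsub : {s | s ∈ Ico 0 t ∧ h s = 0} ⊆ Ico 0 t := fun s hs => hs.1
  rw [← Measure.restrict_eq_self _ hsub, hmeas,
    withDensity_apply_eq_zero' hHi.aestronglyMeasurable.aemeasurable.ennreal_ofReal]
  convert measure_empty (μ := volume)
  ext s
  simp only [mem_inter_iff, mem_ofPred_eq, mem_empty_iff_false, iff_false]
  rintro ⟨h1, h2, h3⟩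
  exact h1 (by simp [hH, h2, h3])

/-! ### Measurability of allocations -/

/-- The primitive of any nonnegative function, integrable or not, is a.e. measurable. -/
theorem aemeasurable_primitive {g : ℝ → ℝ} (hg : ∀ s, 0 ≤ g s) (R : ℝ) :
    AEMeasurable (fun t => ∫ s in (0 : ℝ)..t, g s) (volume.restrict (Icc 0 R)) := by
  -- `D` is an interval on which the primitive is monotone; at nonnegative points outside `D` the
  -- integral has the default value `0`.
  set D : Set ℝ := {t | 0 ≤ t ∧ IntervalIntegrable g volume 0 t} with hD
  have hsub : ∀ s t, 0 ≤ s → s ≤ t → t ∈ D → s ∈ D := fun s t h0 hst ht =>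
    ⟨h0, ht.2.mono_set (by
      rw [uIcc_of_le h0, uIcc_of_le (h0.trans hst)]; exact Icc_subset_Icc_right hst)⟩
  have hDm : MeasurableSet D :=
    OrdConnected.measurableSet ⟨fun s hs t ht z hz => hsub z t (hs.1.trans hz.1) hz.2 ht⟩
  have hmono : MonotoneOn (fun t => ∫ s in (0 : ℝ)..t, g s) D := fun s hs t ht hst => by
    have : 0 ≤ (∫ z in (0 : ℝ)..t, g z) - ∫ z in (0 : ℝ)..s, g z := by
      rw [intervalIntegral.integral_interval_sub_left ht.2 hs.2]
      exact intervalIntegral.integral_nonneg hst fun z _ => hg z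
    simpa using this
  have h1 := aemeasurable_restrict_of_monotoneOn (μ := volume) hDm hmono
  have h2 := (aemeasurable_indicator_iff hDm).2 h1
  refine (h2.restrict (s := Icc 0 R)).congr ?_
  filter_upwards [ae_restrict_mem measurableSet_Icc] with t ht
  by_cases htD : t ∈ D
  · simp [htD]
  · rw [indicator_of_notMem htD, intervalIntegral.integral_undef fun h => htD ⟨ht.1, h⟩]

/-! ### Typical primitive sequences -/

/-- The sum of the first `M` terms and of all blocks of length at least `k₀` that start before `M`
are close to their means. -/
structure IsTypical (x : ℕ → ℝ) (δ : ℝ) (M k₀ : ℕ) : Prop where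
  total : (1 - δ) * M < ∑ i ∈ Finset.range M, x i
  lower : ∀ m k, m ≤ M → k₀ ≤ k → k ≤ M + 1 → (1 - δ) * k ≤ ∑ i ∈ Finset.range k, x (m + i)
  upper : ∀ m k, m ≤ M → k₀ ≤ k → k ≤ M + 1 → ∑ i ∈ Finset.range k, x (m + i) ≤ (1 + δ) * k

namespace IsTypical

variable {x : ℕ → ℝ} {δ r R : ℝ} {M k₀ : ℕ}

theorem horizon_lt_sum_div (h : IsTypical x δ M k₀) (hr : 0 < r) (hR : R * r ≤ (1 - δ) * M) :
    R < ∑ i ∈ Finset.range M, x i / r := by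
  rw [← Finset.sum_div, lt_div_iff₀ hr]
  exact hR.trans_lt h.total

theorem lower_div (h : IsTypical x δ M k₀) (hr : 0 < r) {m k : ℕ} (hm : m ≤ M) (hk : k₀ ≤ k)
    (hkM : k ≤ M + 1) : (1 - δ) * k / r ≤ ∑ i ∈ Finset.range k, x (m + i) / r := by
  rw [← Finset.sum_div]
  exact div_le_div_of_nonneg_right (h.lower m k hm hk hkM) hr.le

theorem upper_div (h : IsTypical x δ M k₀) (hr : 0 < r) {m k : ℕ} (hm : m ≤ M) (hk : k₀ ≤ k)
    (hkM : k ≤ M + 1) : ∑ i ∈ Finset.range k, x (m + i) / r ≤ (1 + δ) * k / r := by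
  rw [← Finset.sum_div]
  exact div_le_div_of_nonneg_right (h.upper m k hm hk hkM) hr.le

end IsTypical

/-- Union bound for the probability that an i.i.d. sequence is not typical. -/
theorem measureReal_not_isTypical_le {Ω : Type*} [MeasurableSpace Ω] {P : Measure Ω}
    [IsProbabilityMeasure P] {X : ℕ → Ω → ℝ} {δ θ : ℝ} (hθ : 0 ≤ θ)
    (hX : ∀ m k : ℕ,
      P.real {ω | (1 + δ) * k ≤ ∑ i ∈ Finset.range k, X (m + i) ω} ≤ Real.exp (-θ * k) ∧
      P.real {ω | ∑ i ∈ Finset.range k, X (m + i) ω ≤ (1 - δ) * k} ≤ Real.exp (-θ * k))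
    (M k₀ : ℕ) :
    P.real {ω | ¬ IsTypical (fun i => X i ω) δ M k₀} ≤
      Real.exp (-θ * M) + 2 * ((M : ℝ) + 2) ^ 2 * Real.exp (-θ * k₀) := by
  -- Pairs of starting index and length of a block: at most `(M + 1)(M + 2)` of them, each failing
  -- with probability at most `2 exp(-θ k₀)`.
  set S : Finset (ℕ × ℕ) :=
    (Finset.range (M + 1) ×ˢ Finset.range (M + 2)).filter fun p => k₀ ≤ p.2 with hS
  set B : ℕ × ℕ → Set Ω := fun p =>
    {ω | (1 + δ) * p.2 ≤ ∑ i ∈ Finset.range p.2, X (p.1 + i) ω} ∪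
    {ω | ∑ i ∈ Finset.range p.2, X (p.1 + i) ω ≤ (1 - δ) * p.2} with hB
  have hsub : {ω | ¬ IsTypical (fun i => X i ω) δ M k₀} ⊆
      {ω | ∑ i ∈ Finset.range M, X (0 + i) ω ≤ (1 - δ) * M} ∪ ⋃ p ∈ S, B p := by
    intro ω hω
    by_contra hnot
    simp only [mem_union, mem_iUnion, not_or, not_exists, mem_ofPred_eq, not_le, zero_add] at hnot
    obtain ⟨h1, h2⟩ := hnot
    have hmem : ∀ m k, m ≤ M → k₀ ≤ k → k ≤ M + 1 → (m, k) ∈ S := fun m k hm hk hkM => by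
      simp only [hS, Finset.mem_filter, Finset.mem_product, Finset.mem_range]
      omega
    refine hω ⟨h1, fun m k hm hk hkM => ?_, fun m k hm hk hkM => ?_⟩
    · have := h2 (m, k) (hmem m k hm hk hkM)
      simp only [hB, mem_union, mem_ofPred_eq, not_or, not_le] at this
      exact this.2.le
    · have := h2 (m, k) (hmem m k hm hk hkM)
      simp only [hB, mem_union, mem_ofPred_eq, not_or, not_le] at this
      exact this.1.le
  have hcard : (S.card : ℝ) ≤ ((M : ℝ) + 2) ^ 2 := by
    have h1 : S.card ≤ (M + 1) * (M + 2) := by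
      refine (Finset.card_filter_le _ _).trans ?_
      simp
    have h2 : (M + 1) * (M + 2) ≤ (M + 2) ^ 2 := by nlinarith
    exact_mod_cast h1.trans h2
  have hone : ∀ p ∈ S, P.real (B p) ≤ 2 * Real.exp (-θ * k₀) := by
    intro p hp
    have hk : (k₀ : ℝ) ≤ p.2 := by exact_mod_cast (Finset.mem_filter.1 hp).2
    have hexp : Real.exp (-θ * p.2) ≤ Real.exp (-θ * k₀) :=
      Real.exp_le_exp.2 (by linarith [mul_le_mul_of_nonneg_left hk hθ])
    refine (measureReal_union_le _ _).trans ?_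
    linarith [(hX p.1 p.2).1, (hX p.1 p.2).2]
  calc P.real {ω | ¬ IsTypical (fun i => X i ω) δ M k₀}
      ≤ P.real ({ω | ∑ i ∈ Finset.range M, X (0 + i) ω ≤ (1 - δ) * M} ∪ ⋃ p ∈ S, B p) :=
        measureReal_mono hsub
    _ ≤ Real.exp (-θ * M) + ∑ p ∈ S, P.real (B p) :=
        (measureReal_union_le _ _).trans
          (add_le_add (hX 0 M).2 (measureReal_biUnion_finset_le _ _))
    _ ≤ Real.exp (-θ * M) + S.card * (2 * Real.exp (-θ * k₀)) := by
        gcongr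
        simpa using Finset.sum_le_card_nsmul S _ _ hone
    _ ≤ Real.exp (-θ * M) + ((M : ℝ) + 2) ^ 2 * (2 * Real.exp (-θ * k₀)) := by gcongr
    _ = _ := by ring

/-! ### The crisscross network on a typical path -/

namespace CrisscrossData

variable {Ω : Type*} [MeasurableSpace Ω] {N : CrisscrossData Ω} {P : Measure Ω}
  {c l₀ g₀ : ℝ} {n : ℕ} {T : Fin 3 → ℝ → Ω → ℝ} {ω : Ω}

open Classical in
/-- Indicator function of the service of class `j` along the path `ω`. -/
noncomputable def serviceRate (N : CrisscrossData Ω) (P : Measure Ω) (c l₀ g₀ : ℝ) (n : ℕ)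
    (T : Fin 3 → ℝ → Ω → ℝ) (ω : Ω) (j : Fin 3) (s : ℝ) : ℝ :=
  if N.Serves P c l₀ g₀ n (N.queue n T s ω) j then 1 else 0

theorem serviceRate_eq_zero_or_one (j : Fin 3) (s : ℝ) :
    N.serviceRate P c l₀ g₀ n T ω j s = 0 ∨ N.serviceRate P c l₀ g₀ n T ω j s = 1 := by
  unfold serviceRate
  split_ifs <;> simp

/-- The path `ω` is generated by the policy, and no renewal sequence is exhausted before `R`. -/
structure RegularPath (N : CrisscrossData Ω) (P : Measure Ω) (c l₀ g₀ : ℝ) (n : ℕ)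
    (T : Fin 3 → ℝ → Ω → ℝ) (ω : Ω) (R : ℝ) (M : ℕ) : Prop where
  alloc : ∀ j s, 0 ≤ s → T j s ω = ∫ z in (0 : ℝ)..s, N.serviceRate P c l₀ g₀ n T ω j z
  pos_u : ∀ k i, 0 < N.u k i ω / N.lamN n k
  pos_v : ∀ j i, 0 < N.v j i ω / N.muN n j
  horizon_u : ∀ k, R < ∑ i ∈ Finset.range M, N.u k i ω / N.lamN n k
  horizon_v : ∀ j, R < ∑ i ∈ Finset.range M, N.v j i ω / N.muN n j

namespace RegularPath

variable {R : ℝ} {M : ℕ}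

theorem queue_eq (h : N.RegularPath P c l₀ g₀ n T ω R M) {s : ℝ} (hs : 0 ≤ s) :
    N.queue n T s ω =
      ![(renewalCount (fun i => N.u 0 i ω / N.lamN n 0) s : ℝ) -
          renewalCount (fun i => N.v 0 i ω / N.muN n 0)
            (∫ z in (0 : ℝ)..s, N.serviceRate P c l₀ g₀ n T ω 0 z),
        (renewalCount (fun i => N.u 1 i ω / N.lamN n 1) s : ℝ) -
          renewalCount (fun i => N.v 1 i ω / N.muN n 1)
            (∫ z in (0 : ℝ)..s, N.serviceRate P c l₀ g₀ n T ω 1 z),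
        (renewalCount (fun i => N.v 1 i ω / N.muN n 1)
            (∫ z in (0 : ℝ)..s, N.serviceRate P c l₀ g₀ n T ω 1 z) : ℝ) -
          renewalCount (fun i => N.v 2 i ω / N.muN n 2)
            (∫ z in (0 : ℝ)..s, N.serviceRate P c l₀ g₀ n T ω 2 z)] := by
  rw [← h.alloc 0 s hs, ← h.alloc 1 s hs, ← h.alloc 2 s hs]
  rfl

theorem alloc_mem {s : ℝ} (hs : 0 ≤ s) (hsR : s ≤ R) (j : Fin 3) :
    0 ≤ (∫ z in (0 : ℝ)..s, N.serviceRate P c l₀ g₀ n T ω j z) ∧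
      (∫ z in (0 : ℝ)..s, N.serviceRate P c l₀ g₀ n T ω j z) ≤ R :=
  ⟨(integral_mem_Icc (serviceRate_eq_zero_or_one j) hs).1,
    (integral_mem_Icc (serviceRate_eq_zero_or_one j) hs).2.trans hsR⟩

open Classical in
/-- Since the queue lengths are integers, the service indicators are a.e. measurable. -/
theorem intervalIntegrable_serviceRate (h : N.RegularPath P c l₀ g₀ n T ω R M) (hR : 0 ≤ R)
    (j : Fin 3) : IntervalIntegrable (N.serviceRate P c l₀ g₀ n T ω j) volume 0 R := by
  have hu : ∀ k, Measurable fun s =>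
      renewalCount (fun i => N.u k i ω / N.lamN n k) (max 0 (min s R)) := fun k =>
    (monotone_renewalCount_clamp (h.pos_u k) (h.horizon_u k) hR).measurable
  have hv : ∀ k, AEMeasurable (fun s => renewalCount (fun i => N.v k i ω / N.muN n k)
      (max 0 (min (∫ z in (0 : ℝ)..s, N.serviceRate P c l₀ g₀ n T ω k z) R)))
      (volume.restrict (Icc 0 R)) := fun k =>
    (monotone_renewalCount_clamp (h.pos_v k) (h.horizon_v k) hR).measurable.comp_aemeasurable
      (aemeasurable_primitive (fun s => by
        rcases serviceRate_eq_zero_or_one (N := N) (P := P) (c := c) (l₀ := l₀) (g₀ := g₀) (n := n)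
          (T := T) (ω := ω) k s with h | h <;> simp [h]) R)
  set G : ℕ × ℕ × ℕ × ℕ × ℕ → ℝ := fun p =>
    if N.Serves P c l₀ g₀ n ![(p.1 : ℝ) - p.2.2.1, (p.2.1 : ℝ) - p.2.2.2.1,
      (p.2.2.2.1 : ℝ) - p.2.2.2.2] j then 1 else 0 with hG
  -- The five counts range over a countable discrete space, so no measurability of the free boundary
  -- is required.
  have hGm : Measurable G := measurable_of_countable G
  have hmeas := hGm.comp_aemeasurable ((hu 0).aemeasurable.prodMk ((hu 1).aemeasurable.prodMk
    ((hv 0).prodMk ((hv 1).prodMk (hv 2)))))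
  rw [intervalIntegrable_iff_integrableOn_Icc_of_le hR]
  refine Integrable.of_bound (C := 1) (hmeas.congr ?_).aestronglyMeasurable ?_
  · filter_upwards [ae_restrict_mem measurableSet_Icc] with s hs
    have hclamp : ∀ r, 0 ≤ r → r ≤ R → max 0 (min r R) = r := fun r h1 h2 => by
      rw [min_eq_left h2, max_eq_right h1]
    have hm := fun j => alloc_mem (N := N) (P := P) (c := c) (l₀ := l₀) (g₀ := g₀) (n := n)
      (T := T) (ω := ω) hs.1 hs.2 j
    have hrate : N.serviceRate P c l₀ g₀ n T ω j s =
      if N.Serves P c l₀ g₀ n (N.queue n T s ω) j then 1 else 0 := rfl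
    rw [hrate, h.queue_eq hs.1]
    simp only [Function.comp_apply, hG]
    rw [hclamp s hs.1 hs.2, hclamp _ (hm 0).1 (hm 0).2, hclamp _ (hm 1).1 (hm 1).2,
      hclamp _ (hm 2).1 (hm 2).2]
  · refine Eventually.of_forall fun s => ?_
    rcases serviceRate_eq_zero_or_one (N := N) (P := P) (c := c) (l₀ := l₀) (g₀ := g₀) (n := n)
          (T := T) (ω := ω) j s with h | h <;> simp [h]

theorem serviceRate_eq_zero {j : Fin 3} {s : ℝ} (hq : N.queue n T s ω j ≤ 0) :
    N.serviceRate P c l₀ g₀ n T ω j s = 0 := by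
  refine if_neg fun hS => ?_
  fin_cases j
  · exact absurd hS.1 (not_lt.2 hq)
  · exact absurd hS.1 (not_lt.2 hq)
  · exact absurd hS (not_lt.2 hq)

theorem queue_zero_nonneg (h : N.RegularPath P c l₀ g₀ n T ω R M) {s : ℝ}
    (hs : 0 ≤ s) (hsR : s ≤ R) : 0 ≤ N.queue n T s ω 0 := by
  have := departures_le_arrivals (h.pos_v 0) (h.horizon_v 0) (serviceRate_eq_zero_or_one 0)
    (h.intervalIntegrable_serviceRate (hs.trans hsR) 0)
    (arr := renewalCount fun i => N.u 0 i ω / N.lamN n 0)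
    (fun r s hr hrs hs => renewalCount_mono (h.pos_u 0) (h.horizon_u 0) hr hrs hs)
    (fun s hs _ hle => serviceRate_eq_zero (by
      rw [h.queue_eq hs]
      simpa using hle)) hs hsR
  rw [h.queue_eq hs]
  simpa using this

theorem departures_three_le (h : N.RegularPath P c l₀ g₀ n T ω R M) {s : ℝ}
    (hs : 0 ≤ s) (hsR : s ≤ R) :
    renewalCount (fun i => N.v 2 i ω / N.muN n 2)
        (∫ z in (0 : ℝ)..s, N.serviceRate P c l₀ g₀ n T ω 2 z) ≤
      renewalCount (fun i => N.v 1 i ω / N.muN n 1)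
        (∫ z in (0 : ℝ)..s, N.serviceRate P c l₀ g₀ n T ω 1 z) := by
  refine departures_le_arrivals (h.pos_v 2) (h.horizon_v 2) (serviceRate_eq_zero_or_one 2)
    (h.intervalIntegrable_serviceRate (hs.trans hsR) 2)
    (arr := fun s => renewalCount (fun i => N.v 1 i ω / N.muN n 1)
        (∫ z in (0 : ℝ)..s, N.serviceRate P c l₀ g₀ n T ω 1 z))
    (fun r s hr hrs hs => renewalCount_mono (h.pos_v 1) (h.horizon_v 1)
      (alloc_mem hr (hrs.trans hs) 1).1
      (sub_nonneg.1 (integral_sub_mem_Icc (serviceRate_eq_zero_or_one 1)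
        (h.intervalIntegrable_serviceRate (hr.trans (hrs.trans hs)) 1) hr hrs hs).1)
      (alloc_mem (hr.trans hrs) hs 1).2)
    (fun s hs _ hle => serviceRate_eq_zero ?_) hs hsR
  rw [h.queue_eq hs]
  simpa using hle

/-- Class 2 is served whenever buffer 2 is nonempty and buffer 3 is below the lower threshold. -/
theorem serviceRate_one_eq_one (h : N.RegularPath P c l₀ g₀ n T ω R M) (hc : 1 < c)
    (hl : 0 ≤ l₀ * Real.log n) (hmu : ∀ j, 0 < N.muN n j) {s : ℝ} (hs : 0 ≤ s) (hsR : s ≤ R)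
    (h1 : 0 < N.queue n T s ω 1) (h2 : N.queue n T s ω 2 < thrL l₀ n - 1) :
    N.serviceRate P c l₀ g₀ n T ω 1 s = 1 := by
  have hLC : thrL l₀ n ≤ thrC c l₀ n := by
    unfold thrL thrC
    exact_mod_cast Int.floor_le_floor (by rw [mul_assoc]; exact le_mul_of_one_le_left hl hc.le)
  have h0 := h.queue_zero_nonneg hs hsR
  have h3 : 0 ≤ N.muN n 1 / N.muN n 0 * N.queue n T s ω 0 :=
    mul_nonneg (div_pos (hmu 1) (hmu 0)).le h0
  -- As queue 1 is nonnegative, a short buffer 3 puts the state in the first regime of the policy,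
  -- and `L ≤ C` selects class 2 there.
  exact if_pos ⟨h1, Or.inl ⟨by linarith, by linarith⟩⟩

/-- On a path on which server 2 is busy whenever queue 2 is large, the idleness event fails. -/
theorem notMem_idleEvent {t d : ℝ} (hn : 0 < n) (h : N.RegularPath P c l₀ g₀ n T ω (n * t) M)
    (hbusy : ∀ s, 0 ≤ s → s ≤ n * t → d * l₀ * Real.log n ≤ N.queue n T s ω 1 →
      0 < N.queue n T s ω 2) : ω ∉ N.idleEvent l₀ d n T t := by
  have hn' : (0 : ℝ) < n := by exact_mod_cast hn
  have hsq : 0 < √(n : ℝ) := Real.sqrt_pos.2 hn'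
  intro hω
  refine hω ?_
  rcases lt_or_ge t 0 with ht | ht
  · simp [Ico_eq_empty_of_le ht.le]
  set g := N.serviceRate P c l₀ g₀ n T ω 2 with hg
  have hint : IntervalIntegrable g volume 0 (n * t) :=
    h.intervalIntegrable_serviceRate (by positivity) 2
  have hintn : IntervalIntegrable (fun z => g (n * z)) volume 0 t := by
    have := hint.comp_mul_left (c := (n : ℝ))
    simpa [hn'.ne'] using this
  -- In the density, the factor `n` comes from the change of time and `1 / √n` from the scaling of
  -- space.
  have hnull := stieltjesMeasure_zero_density (f := scaledIdle₂ n T ω) (t := t)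
    (h := fun z => n / √(n : ℝ) * (1 - g (n * z)))
    (fun s hs => by simp [scaledIdle₂, max_eq_right hs, h.alloc 2 0 le_rfl])
    (fun s hs => by
      have hi : IntervalIntegrable (fun z => g (n * z)) volume 0 s :=
        hintn.mono_set (by
          rw [uIcc_of_le hs.1, uIcc_of_le (hs.1.trans hs.2)]; exact Icc_subset_Icc_right hs.2)
      rw [scaledIdle₂, max_eq_left hs.1, h.alloc 2 _ (mul_nonneg hn'.le hs.1),
        intervalIntegral.integral_const_mul, intervalIntegral.integral_sub (by simp) hi,
        intervalIntegral.integral_comp_mul_left _ hn'.ne']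
      simp only [intervalIntegral.integral_const, smul_eq_mul, mul_zero, sub_zero, mul_one]
      field_simp
      rfl)
    (fun s => mul_nonneg (by positivity) (by
      rcases serviceRate_eq_zero_or_one (N := N) (P := P) (c := c) (l₀ := l₀) (g₀ := g₀) (n := n)
        (T := T) (ω := ω) 2 (n * s) with h | h <;> simp [hg, h]))
    ((by simp : IntervalIntegrable (fun _ => (1 : ℝ)) volume 0 t).sub hintn |>.const_mul _)
  rw [lintegral_congr_ae (g := fun _ => 0), lintegral_zero]
  refine (ae_restrict_iff' measurableSet_Ico).2 ?_
  filter_upwards [measure_eq_zero_iff_ae_notMem.1 hnull] with s hs hsI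
  refine indicator_of_notMem (fun hmem => hs ⟨hsI, ?_⟩) _
  have hq : d * l₀ * Real.log n ≤ N.queue n T (n * s) ω 1 :=
    (div_le_div_iff_of_pos_right hsq).1 hmem
  have hpos := hbusy (n * s) (mul_nonneg hn'.le hsI.1)
    (mul_le_mul_of_nonneg_left hsI.2.le hn'.le) hq
  have hg1 : g (n * s) = 1 := if_pos hpos
  simp [hg1]

end RegularPath

end CrisscrossData

/-! ### Typical paths of the network -/

namespace CrisscrossData

/-- All normalized interarrival and service times, as one family of sequences. -/
def primitive {Ω : Type*} (N : CrisscrossData Ω) : Fin 2 ⊕ Fin 3 → ℕ → Ω → ℝ :=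
  Sum.elim N.u N.v

/-- All arrival and service rates of the `n`-th network. -/
def rateN {Ω : Type*} (N : CrisscrossData Ω) (n : ℕ) : Fin 2 ⊕ Fin 3 → ℝ :=
  Sum.elim (N.lamN n) (N.muN n)

/-- On a typical path server 2 does not idle while queue 2 is large. -/
theorem notMem_idleEvent_of_isTypical {Ω : Type*} [MeasurableSpace Ω] {N : CrisscrossData Ω}
    {P : Measure Ω} {c l₀ g₀ t δ : ℝ} {n M k₀ : ℕ} {T : Fin 3 → ℝ → Ω → ℝ} {ω : Ω} (hn : 0 < n)
    (hc : 1 < c)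
    (halloc : ∀ j s, 0 ≤ s → T j s ω = ∫ z in (0 : ℝ)..s, N.serviceRate P c l₀ g₀ n T ω j z)
    (hpos : ∀ i m, 0 < N.primitive i m ω) (hrate_pos : ∀ i, 0 < N.rateN n i)
    (htyp : ∀ i, IsTypical (fun m => N.primitive i m ω) δ M k₀)
    (hM : ∀ i, n * t * N.rateN n i ≤ (1 - δ) * M)
    (hδ : 0 < δ) (hδ' : δ ≤ 1 / 8)
    (hrate : (1 + δ) * N.muN n 2 ≤ (1 - 2 * δ) * N.muN n 1)
    (hlm : N.lamN n 1 ≤ 2 * N.muN n 2)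
    (hk₀ : 3 ≤ δ * k₀) (hk₀K : (k₀ : ℝ) ≤ l₀ * Real.log n / 4 + 1) (hK : 0 ≤ l₀ * Real.log n) :
    ω ∉ N.idleEvent l₀ 4 n T t := by
  have hlam : ∀ k, 0 < N.lamN n k := fun k => hrate_pos (Sum.inl k)
  have hmu : ∀ j, 0 < N.muN n j := fun j => hrate_pos (Sum.inr j)
  have hreg : N.RegularPath P c l₀ g₀ n T ω (n * t) M :=
    { alloc := halloc
      pos_u := fun k i => div_pos (hpos (Sum.inl k) i) (hlam k)
      pos_v := fun j i => div_pos (hpos (Sum.inr j) i) (hmu j)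
      horizon_u := fun k => (htyp (Sum.inl k)).horizon_lt_sum_div (hlam k) (hM (Sum.inl k))
      horizon_v := fun j => (htyp (Sum.inr j)).horizon_lt_sum_div (hmu j) (hM (Sum.inr j)) }
  refine hreg.notMem_idleEvent hn fun s hs hsR hlarge => ?_
  have hR := hs.trans hsR
  rw [hreg.queue_eq hs] at hlarge ⊢
  have hlarge' : 4 * (l₀ * Real.log n) ≤ (renewalCount (fun i => N.u 1 i ω / N.lamN n 1) s : ℝ) -
      renewalCount (fun i => N.v 1 i ω / N.muN n 1)
        (∫ z in (0 : ℝ)..s, N.serviceRate P c l₀ g₀ n T ω 1 z) := by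
    rw [← mul_assoc]
    exact hlarge
  -- One unit is lost in the threshold `C - 1` of the policy and less than one in the floor defining
  -- `L`, hence `K - 2 ≤ ℓ`.
  have key := downstream_pos_of_upstream_large (ℓ := thrL l₀ n - 1)
    (hreg.pos_u 1) (hreg.pos_v 1) (hreg.pos_v 2) (hreg.horizon_u 1)
    (hreg.horizon_v 1) (hreg.horizon_v 2) (serviceRate_eq_zero_or_one 1)
    (serviceRate_eq_zero_or_one 2) (hreg.intervalIntegrable_serviceRate hR 1)
    (hreg.intervalIntegrable_serviceRate hR 2) (fun r h0 hr => hreg.departures_three_le h0 hr)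
    (fun r h0 hr h1 h2 => hreg.serviceRate_one_eq_one hc hK hmu h0 hr
      (by rw [hreg.queue_eq h0]; exact h1) (by rw [hreg.queue_eq h0]; exact h2))
    (hlam 1) (hmu 1) (hmu 2) hδ hδ' hrate hlm
    (fun m k => (htyp (Sum.inl 1)).lower_div (hlam 1))
    (fun m k => (htyp (Sum.inr 1)).upper_div (hmu 1))
    (fun m k => (htyp (Sum.inr 2)).lower_div (hmu 2))
    hk₀ hk₀K (by unfold thrL; linarith [Int.sub_one_lt_floor (l₀ * Real.log n)]) hs hsR hlarge'
  exact sub_pos.2 (by exact_mod_cast key)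

/-! ### Constants uniform in `n` -/

section Assumptions

variable {Ω : Type*} [MeasurableSpace Ω] {P : Measure Ω} {N : CrisscrossData Ω}

theorem zero_mem_interior_integrableExpSet {Y : Ω → ℝ} {r : ℝ} (hr : 0 < r) {O : Set ℝ}
    (hO : IsOpen O) (h0 : (0 : ℝ) ∈ O)
    (hint : ∀ l ∈ O, Integrable (fun ω => Real.exp (l * Y ω / r)) P) :
    (0 : ℝ) ∈ interior (integrableExpSet Y P) := by
  rw [mem_interior_iff_mem_nhds]
  have : Tendsto (fun s : ℝ => s * r) (𝓝 0) (𝓝 0) := by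
    simpa using (tendsto_id (x := 𝓝 (0 : ℝ))).mul_const r
  filter_upwards [this (hO.mem_nhds h0)] with s hs
  have h := hint (s * r) hs
  have e : ∀ ω, s * r * Y ω / r = s * Y ω := fun ω => by field_simp
  simp only [e] at h
  exact h

theorem Assumptions.exists_block_tails [IsProbabilityMeasure P] (hN : N.Assumptions P) {δ : ℝ}
    (hδ : 0 < δ) : ∃ θ > 0, ∀ i : Fin 2 ⊕ Fin 3, ∀ m k : ℕ,
      P.real {ω | (1 + δ) * k ≤ ∑ j ∈ Finset.range k, N.primitive i (m + j) ω} ≤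
        Real.exp (-θ * k) ∧
      P.real {ω | ∑ j ∈ Finset.range k, N.primitive i (m + j) ω ≤ (1 - δ) * k} ≤
        Real.exp (-θ * k) := by
  have hex : ∀ i : Fin 2 ⊕ Fin 3, ∃ θ > 0, ∀ m k : ℕ,
      P.real {ω | (1 + δ) * k ≤ ∑ j ∈ Finset.range k, N.primitive i (m + j) ω} ≤
        Real.exp (-θ * k) ∧
      P.real {ω | ∑ j ∈ Finset.range k, N.primitive i (m + j) ω ≤ (1 - δ) * k} ≤
        Real.exp (-θ * k) := by
    obtain ⟨O, hO, h0, hint⟩ := hN.exp_moments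
    rintro (k | j)
    · exact _root_.exists_block_tails (X := N.u k) (hN.measurable_u k)
        (hN.indep.precomp (g := fun i : ℕ => Sum.inl (k, i)) fun a b hab => by simpa using hab)
        (hN.identDistrib_u k)
        (zero_mem_interior_integrableExpSet (hN.lam_pos k) hO h0 fun l hl => (hint l hl).1 k)
        (hN.mean_u k) hδ
    · exact _root_.exists_block_tails (X := N.v j) (hN.measurable_v j)
        (hN.indep.precomp (g := fun i : ℕ => Sum.inr (j, i)) fun a b hab => by simpa using hab)
        (hN.identDistrib_v j)
        (zero_mem_interior_integrableExpSet (hN.mu_pos j) hO h0 fun l hl => (hint l hl).2 j)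
        (hN.mean_v j) hδ
  choose θ hθ h using hex
  refine ⟨Finset.univ.inf' Finset.univ_nonempty θ, (Finset.lt_inf'_iff _).2 fun i _ => hθ i,
    fun i m k => ?_⟩
  have hle : Finset.univ.inf' Finset.univ_nonempty θ ≤ θ i := Finset.inf'_le _ (Finset.mem_univ i)
  have hexp : Real.exp (-θ i * k) ≤ Real.exp (-Finset.univ.inf' Finset.univ_nonempty θ * k) :=
    Real.exp_le_exp.2 (by
      linarith [mul_le_mul_of_nonneg_right hle (Nat.cast_nonneg (α := ℝ) k)])
  exact ⟨(h i m k).1.trans hexp, (h i m k).2.trans hexp⟩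

/-- Server 2 is critically loaded by class 3 alone, so `λ₂ = μ₃`; server 1 also carries the positive
load of class 1, so `λ₂ < μ₂`. This strict gap drives the whole argument. -/
theorem Assumptions.mu_two_lt_mu_one (hN : N.Assumptions P) : N.mu 2 < N.mu 1 := by
  have h1 : N.lam 1 = N.mu 2 := (div_eq_one_iff_eq (hN.mu_pos 2).ne').1 hN.traffic_two
  have h2 : N.lam 1 / N.mu 1 < 1 := by
    linarith [hN.traffic_one, div_pos (hN.lam_pos 0) (hN.mu_pos 0)]
  rw [← h1]
  exact (div_lt_one (hN.mu_pos 1)).1 h2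

theorem Assumptions.exists_rate_bound (hN : N.Assumptions P) :
    ∃ κ > 0, ∀ᶠ n in atTop, ∀ i, N.rateN n i ≤ κ := by
  have h : ∀ i : Fin 2 ⊕ Fin 3, ∃ κ > 0, ∀ᶠ n in atTop, N.rateN n i ≤ κ := by
    rintro (k | j)
    · exact ⟨N.lam k + 1, by linarith [hN.lam_pos k],
        (hN.tendsto_lam k).eventually_le_const (lt_add_one _)⟩
    · exact ⟨N.mu j + 1, by linarith [hN.mu_pos j],
        (hN.tendsto_mu j).eventually_le_const (lt_add_one _)⟩
  choose κ hκ h using h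
  refine ⟨∑ i, κ i, Finset.sum_pos (fun i _ => hκ i) Finset.univ_nonempty, ?_⟩
  filter_upwards [eventually_all.2 h] with n hn i
  exact (hn i).trans (Finset.single_le_sum (fun i _ => (hκ i).le) (Finset.mem_univ i))

/-- A margin `δ` by which class 2 is served faster than class 3, uniformly in large `n`. -/
theorem Assumptions.exists_margin (hN : N.Assumptions P) :
    ∃ δ > 0, δ ≤ 1 / 8 ∧
      ∀ᶠ n in atTop, (1 + δ) * N.muN n 2 ≤ (1 - 2 * δ) * N.muN n 1 := by
  have h1 := hN.mu_pos 1
  have h2 := hN.mu_pos 2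
  have hlt := hN.mu_two_lt_mu_one
  -- In the limit the required inequality costs `δ μ₃ + 2 δ μ₂ < 3 δ μ₂`, while the available gap
  -- `μ₂ - μ₃` is `8 δ μ₂`.
  set δ := (N.mu 1 - N.mu 2) / (8 * N.mu 1) with hδ
  have hδ0 : 0 < δ := div_pos (by linarith) (by linarith)
  have hδ1 : δ * (8 * N.mu 1) = N.mu 1 - N.mu 2 := div_mul_cancel₀ _ (by positivity)
  refine ⟨δ, hδ0, ?_, ?_⟩
  · rw [hδ, div_le_iff₀ (by linarith)]; linarith
  · refine (((hN.tendsto_mu 2).const_mul (1 + δ)).eventually_lt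
      ((hN.tendsto_mu 1).const_mul (1 - 2 * δ)) ?_).mono fun n hn => hn.le
    nlinarith [mul_pos hδ0 h1, mul_lt_mul_of_pos_left hlt hδ0]

end Assumptions

end CrisscrossData

/-! ### The probability estimate -/

open CrisscrossData in
theorem theorem5p5 {Ω : Type*} [MeasurableSpace Ω] (P : Measure Ω) [IsProbabilityMeasure P]
    (N : CrisscrossData Ω) (hN : N.Assumptions P) :
    ∃ (n₁ : ℕ) (ε : ℝ), 0 < ε ∧ ε < 1 ∧
      ∀ c : ℝ, 1 < c →
        ∃ γ₁ γ₂ γ₃ γ₄ d : ℝ, 0 < γ₁ ∧ 0 < γ₂ ∧ 0 < γ₃ ∧ 0 < γ₄ ∧ 0 < d ∧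
          ∀ l₀ g₀ : ℝ, 1 < l₀ → 0 < g₀ →
            ∀ (n : ℕ) (t : ℝ), n₁ ≤ n → 2 / ε ≤ n * t →
              ∀ T : Fin 3 → ℝ → Ω → ℝ, N.FollowsPolicy P c l₀ g₀ n T →
                P (N.idleEvent l₀ d n T t) ≤
                  ENNReal.ofReal
                    (γ₁ * (n * t + 1) ^ 2 * Real.exp (-γ₂ * (n * t)) +
                      γ₃ * (n * t + 1) ^ 3 * (n : ℝ) ^ (-γ₄ * l₀)) := by
  obtain ⟨δ, hδ, hδ', hmargin⟩ := hN.exists_margin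
  obtain ⟨κ, hκ, hbound⟩ := hN.exists_rate_bound
  obtain ⟨θ, hθ, htails⟩ := hN.exists_block_tails hδ
  have hlm : ∀ᶠ n in atTop, N.lamN n 1 ≤ 2 * N.muN n 2 := by
    refine ((hN.tendsto_lam 1).eventually_lt ((hN.tendsto_mu 2).const_mul 2) ?_).mono
      fun n hn => hn.le
    rw [(div_eq_one_iff_eq (hN.mu_pos 2).ne').1 hN.traffic_two]
    linarith [hN.mu_pos 2]
  -- This makes `δ K ≥ 12`, hence `δ k₀ ≥ 3` for `k₀ = ⌈K / 4⌉`.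
  have hlog : ∀ᶠ n : ℕ in atTop, 12 / δ ≤ Real.log n :=
    (Real.tendsto_log_atTop.comp tendsto_natCast_atTop_atTop).eventually_ge_atTop _
  obtain ⟨n₁, hn₁⟩ := eventually_atTop.1
    (hmargin.and (hbound.and (hlm.and (hlog.and (eventually_ge_atTop 1)))))
  -- Any `ε` would do, as only `nt ≥ 0` is needed. The `5` counts the primitive sequences, `θ (2κ)`
  -- comes from `M ≥ 2κnt`, the third constant is `5 · 2` times the square from `M + 2 ≤ (2κ + 3)(nt
  -- + 1)`, and `θ / 4` comes from `k₀ ≥ K / 4`.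
  refine ⟨n₁, 1 / 2, by norm_num, by norm_num, fun c hc =>
    ⟨5, θ * (2 * κ), 10 * (2 * κ + 3) ^ 2, θ / 4, 4, by norm_num, by positivity, by positivity,
      by positivity, by norm_num, fun l₀ g₀ hl₀ _ n t hn ht T hT => ?_⟩⟩
  obtain ⟨hmargin, hbound, hlm, hlog, hn1⟩ := hn₁ n hn
  have hnt : 0 ≤ (n : ℝ) * t := by linarith
  set K := l₀ * Real.log n with hK
  have hlog0 : 0 < Real.log n := lt_of_lt_of_le (by positivity) hlog
  have hlogK : Real.log n ≤ K := le_mul_of_one_le_left hlog0.le hl₀.le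
  have hδK : 12 ≤ δ * K := by
    have := (div_le_iff₀ hδ).1 (hlog.trans hlogK)
    linarith
  have hK0 : 0 ≤ K := hlog0.le.trans hlogK
  set k₀ := ⌈K / 4⌉₊ with hk₀
  set M := ⌈2 * κ * (n * t)⌉₊ with hM
  have hk₀K : K / 4 ≤ k₀ := Nat.le_ceil _
  have hMt : 2 * κ * (n * t) ≤ M := Nat.le_ceil _
  have hk₀K' : (k₀ : ℝ) ≤ K / 4 + 1 := (Nat.ceil_lt_add_one (by linarith)).le
  have hMt' : (M : ℝ) ≤ 2 * κ * (n * t) + 1 := (Nat.ceil_lt_add_one (by positivity)).le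
  -- The factor `2` in `M` absorbs `1 - δ ≥ 1 / 2`.
  have hhorizon : ∀ i, n * t * N.rateN n i ≤ (1 - δ) * M := fun i => by
    have h1 := mul_le_mul_of_nonneg_left (hbound i) hnt
    have h2 : (1 / 2 : ℝ) * M ≤ (1 - δ) * M :=
      mul_le_mul_of_nonneg_right (by linarith) (Nat.cast_nonneg _)
    linarith
  have hrate_pos : ∀ i, 0 < N.rateN n i := by
    rintro (k | j)
    · exact hN.lamN_pos n hn1 k
    · exact hN.muN_pos n hn1 j
  have hpos : ∀ᵐ ω ∂P, ∀ i m, 0 < N.primitive i m ω := by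
    refine ae_all_iff.2 fun i => ae_all_iff.2 fun m => ?_
    rcases i with k | j
    · exact hN.pos_u k m
    · exact hN.pos_v j m
  set bad : Set Ω := ⋃ i : Fin 2 ⊕ Fin 3, {ω | ¬ IsTypical (fun m => N.primitive i m ω) δ M k₀}
  -- Inclusion up to a null set suffices: outer measure is monotone, so neither event has to be
  -- measurable.
  have hsub : N.idleEvent l₀ 4 n T t ≤ᵐ[P] bad := by
    filter_upwards [hT, hpos] with ω halloc hposω hω
    by_contra hnot
    have htyp : ∀ i, IsTypical (fun m => N.primitive i m ω) δ M k₀ := fun i => by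
      by_contra h
      exact hnot (mem_iUnion.2 ⟨i, h⟩)
    exact notMem_idleEvent_of_isTypical hn1 hc halloc hposω hrate_pos htyp hhorizon hδ hδ' hmargin
      hlm (by linarith [mul_le_mul_of_nonneg_left hk₀K hδ.le]) hk₀K' hK0 hω
  refine (measure_mono_ae hsub).trans ?_
  rw [← ofReal_measureReal]
  refine ENNReal.ofReal_le_ofReal ?_
  have hbad : P.real bad ≤
      5 * (Real.exp (-θ * M) + 2 * ((M : ℝ) + 2) ^ 2 * Real.exp (-θ * k₀)) := by
    refine (measureReal_iUnion_fintype_le _).trans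
      ((Finset.sum_le_card_nsmul _ _ _ fun i _ =>
        measureReal_not_isTypical_le hθ.le (htails i) M k₀).trans (le_of_eq ?_))
    simp
    ring
  have hexpM : Real.exp (-θ * M) ≤ Real.exp (-(θ * (2 * κ)) * (n * t)) :=
    Real.exp_le_exp.2 (by linarith [mul_le_mul_of_nonneg_left hMt hθ.le])
  have hexpk : Real.exp (-θ * k₀) ≤ (n : ℝ) ^ (-(θ / 4) * l₀) := by
    rw [Real.rpow_def_of_pos (by exact_mod_cast hn1)]
    refine Real.exp_le_exp.2 ?_
    have := mul_le_mul_of_nonneg_left hk₀K hθ.le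
    rw [hK] at this
    linarith
  have hone : 1 ≤ (n : ℝ) * t + 1 := by linarith
  have hM2 : (M : ℝ) + 2 ≤ (2 * κ + 3) * (n * t + 1) := by linarith
  have hcube : ((n : ℝ) * t + 1) ^ 2 ≤ (n * t + 1) ^ 3 := pow_le_pow_right₀ hone (by norm_num)
  calc P.real bad
      ≤ 5 * (Real.exp (-θ * M) + 2 * ((M : ℝ) + 2) ^ 2 * Real.exp (-θ * k₀)) := hbad
    _ ≤ 5 * ((n * t + 1) ^ 2 * Real.exp (-(θ * (2 * κ)) * (n * t)) +
          2 * ((2 * κ + 3) ^ 2 * (n * t + 1) ^ 3) * (n : ℝ) ^ (-(θ / 4) * l₀)) := by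
        gcongr
        · exact hexpM.trans (le_mul_of_one_le_left (Real.exp_pos _).le (one_le_pow₀ hone))
        · calc ((M : ℝ) + 2) ^ 2 ≤ ((2 * κ + 3) * (n * t + 1)) ^ 2 := by gcongr
            _ = (2 * κ + 3) ^ 2 * (n * t + 1) ^ 2 := by ring
            _ ≤ _ := by gcongr
    _ = _ := by ring
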